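/- Let $n\ge 2$. A Gelfand–Tsetlin tableau of height $n$ is a triangular array $T(L)$ with complex entries $L=(l_{ij})_{1\le j\le i\le n}$; row $n$ is its top row. For $1\le j\le i\le n$ let $\delta^{ij}$ be the array with entry $1$ at position $(i,j)$ and $0$ elsewhere. Call $T(L)$ generic if $l_{ki}-l_{kj}\notin\mathbb Z$ for all $1\le k\le n-1$ and all $1\le i\ne j\le k$ (no condition is imposed on the top row). Let $T(L)$ be a generic Gelfand–Tsetlin tableau of height $n$. Let $\mathcal B(T(L))$ be the set of all tableaux $T(R)$, $R=(r_{ij})$, with $r_{nj}=l_{nj}$ for $1\le j\le n$ and $r_{ij}-l_{ij}\in\mathbb Z$ for $1\le j\le i\le n-1$, and let $V(T(L))$ be the complex vector space with basis $\mathcal B(T(L))$. Then $V(T(L))$ has the structure of a module over the Lie algebra $\mathfrak{gl}_n=\mathfrak{gl}_n(\mathbb C)$ in which the elementary matrices act on each $T(R)\in\mathcal B(T(L))$ by the Gelfand–Tsetlin formulas $$E_{k,k+1}\,T(R)=-\sum_{i=1}^{k}\frac{\prod_{j=1}^{k+1}(r_{ki}-r_{k+1,j})}{\prod_{1\le j\le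 k,\ j\ne i}(r_{ki}-r_{kj})}\,T(R+\delta^{ki})\qquad(1\le k\le n-1),$$ $$E_{k+1,k}\,T(R)=\sum_{i=1}^{k}\frac{\prod_{j=1}^{k-1}(r_{ki}-r_{k-1,j})}{\prod_{1\le j\le k,\ j\ne i}(r_{ki}-r_{kj})}\,T(R-\delta^{ki})\qquad(1\le k\le n-1),$$ $$E_{k,k}\,T(R)=\Bigl(k-1+\sum_{i=1}^{k}r_{ki}-\sum_{i=1}^{k-1}r_{k-1,i}\Bigr)T(R)\qquad(1\le k\le n).$$ -/

import Mathlib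

/-- Positions `(i, j)` with `1 ≤ j ≤ i ≤ n` (row `i`, counted from the bottom, and place `j`). -/
abbrev GTIndex (n : ℕ) : Type :=
  {p : ℕ × ℕ // 1 ≤ p.2 ∧ p.2 ≤ p.1 ∧ p.1 ≤ n}

/-- Gelfand-Tsetlin tableaux of height `n`: vectors `(l_{ij})` in `ℂ^{n(n+1)/2}`. -/
abbrev GTTableau (n : ℕ) : Type := GTIndex n → ℂ

namespace GTTableau

variable {n : ℕ}

/-- The entry `l_{ij}`, for `1 ≤ j ≤ i ≤ n`. (The value `0` outside this range is never used.) -/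
def entry (L : GTTableau n) (i j : ℕ) : ℂ :=
  if h : 1 ≤ j ∧ j ≤ i ∧ i ≤ n then L ⟨(i, j), h⟩ else 0

/-- The vector `δ^{ij}`: entry `1` at position `(i, j)` and `0` elsewhere. -/
def delta (n i j : ℕ) : GTTableau n :=
  fun p => if p.1 = (i, j) then 1 else 0

/-- No two entries of the same row, below the top row, differ by an integer. -/
def IsGeneric (L : GTTableau n) : Prop :=
  ∀ k i j : ℕ, k < n → 1 ≤ i → i ≤ k → 1 ≤ j → j ≤ k → i ≠ j →
    ¬ ∃ z : ℤ, L.entry k i - L.entry k j = (z : ℂ)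

/-- The set `B(T(L))` of all tableaux with the same top row as `L` and whose entries in the
lower rows differ from those of `L` by integers. -/
def shifts (L : GTTableau n) : Set (GTTableau n) :=
  {R | (∀ j, 1 ≤ j → j ≤ n → R.entry n j = L.entry n j) ∧
    ∀ i j, 1 ≤ j → j ≤ i → i < n → ∃ z : ℤ, R.entry i j - L.entry i j = (z : ℂ)}

theorem add_delta_mem_shifts {L R : GTTableau n} (hR : R ∈ L.shifts) {k : ℕ} (hk : k < n)
    (i : ℕ) : R + delta n k i ∈ L.shifts := by
  obtain ⟨h1, h2⟩ := hR
  refine ⟨fun j a b => ?_, fun p q a b c => ?_⟩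
  · rw [← h1 j a b]
    simp [entry, delta, a, b]
    omega
  · obtain ⟨z, hz⟩ := h2 p q a b c
    simp only [entry, a, b, c.le, and_self, dite_true, delta, Pi.add_apply] at hz ⊢
    by_cases h : (p, q) = (k, i)
    · exact ⟨z + 1, by simp [h] at hz ⊢; linear_combination hz⟩
    · exact ⟨z, by simp [h] at hz ⊢; linear_combination hz⟩

theorem sub_delta_mem_shifts {L R : GTTableau n} (hR : R ∈ L.shifts) {k : ℕ} (hk : k < n)
    (i : ℕ) : R - delta n k i ∈ L.shifts := by
  obtain ⟨h1, h2⟩ := hR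
  refine ⟨fun j a b => ?_, fun p q a b c => ?_⟩
  · rw [← h1 j a b]
    simp [entry, delta, a, b]
    omega
  · obtain ⟨z, hz⟩ := h2 p q a b c
    simp only [entry, a, b, c.le, and_self, dite_true, delta, Pi.sub_apply] at hz ⊢
    by_cases h : (p, q) = (k, i)
    · exact ⟨z - 1, by simp [h] at hz ⊢; linear_combination hz⟩
    · exact ⟨z, by simp [h] at hz ⊢; linear_combination hz⟩

/-- `V(T(L))`, the complex vector space spanned by `B(T(L))`, with basis `B(T(L))`. -/
abbrev V (L : GTTableau n) : Type := L.shifts →₀ ℂ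

/-- The basis vector `T(R)` of `V(T(L))`. -/
noncomputable def T {L : GTTableau n} (R : L.shifts) : L.V := Finsupp.single R 1

/-- The Gelfand-Tsetlin formula for `E_{k,k+1}(T(R))`, `1 ≤ k ≤ n - 1`. -/
noncomputable def raising {L : GTTableau n} (R : L.shifts) (k : ℕ) (hk : k < n) : L.V :=
  -∑ i ∈ Finset.Icc 1 k,
    ((∏ j ∈ Finset.Icc 1 (k + 1), (R.1.entry k i - R.1.entry (k + 1) j)) /
      (∏ j ∈ (Finset.Icc 1 k).erase i, (R.1.entry k i - R.1.entry k j))) •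
        T ⟨R.1 + delta n k i, add_delta_mem_shifts R.2 hk i⟩

/-- The Gelfand-Tsetlin formula for `E_{k+1,k}(T(R))`, `1 ≤ k ≤ n - 1`. -/
noncomputable def lowering {L : GTTableau n} (R : L.shifts) (k : ℕ) (hk : k < n) : L.V :=
  ∑ i ∈ Finset.Icc 1 k,
    ((∏ j ∈ Finset.Icc 1 (k - 1), (R.1.entry k i - R.1.entry (k - 1) j)) /
      (∏ j ∈ (Finset.Icc 1 k).erase i, (R.1.entry k i - R.1.entry k j))) •
        T ⟨R.1 - delta n k i, sub_delta_mem_shifts R.2 hk i⟩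

/-- The Gelfand-Tsetlin formula for `E_{k,k}(T(R))`, `1 ≤ k ≤ n`. -/
noncomputable def diagonal {L : GTTableau n} (R : L.shifts) (k : ℕ) : L.V :=
  ((k : ℂ) - 1 + ∑ i ∈ Finset.Icc 1 k, R.1.entry k i -
    ∑ i ∈ Finset.Icc 1 (k - 1), R.1.entry (k - 1) i) • T R

end GTTableau

/-- The elementary matrix `E_{i,j}` of `gl_n`, for `1 ≤ i, j ≤ n`. -/
def glE (n i j : ℕ) : Matrix (Fin n) (Fin n) ℂ :=
  Matrix.of fun a b => if (a : ℕ) + 1 = i ∧ (b : ℕ) + 1 = j then 1 else 0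

-- `gl_n` is the ring of matrices with the commutator bracket `⁅A, B⁆ = A * B - B * A`.
attribute [local instance] LieRing.ofAssociativeRing

/-! Two independent facts give the module structure.

The first is the Serre presentation of `gl_n`: operators satisfying the Chevalley–Serre relations
extend to a full family of elementary matrices (`exists_isGLFamily`). The proof is by induction on
`m`. The new column of `gl_{m+1}` is generated by `e_m` and the new row by `f_m`. Under `gl_m` they
span the natural representation and its dual (`lie_natural`), and each is commutative
(`lie_natural_natural`); in each case one Serre relation spreads to all index pairs under the action
of `gl_m`.

The second is that the Gelfand–Tsetlin operators satisfy these relations. Each is a sum of weighted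
shifts of one entry, and genericity keeps every denominator nonzero on all of `B(T(L))`. Relations
between distant rows are immediate. In `[E_{k,k+1}, E_{k+1,k}]` the terms shifting two different
entries cancel, and the remaining scalar is a sum of residues (`sum_residues_shifted`), evaluated by
Lagrange interpolation. For adjacent rows, a coefficient depends on an entry `y_j` of the next row
only through the linear factor `x_i - y_j`, so a commutator replaces this factor by a constant
(`commutator_rowOp`). The Serre relations are then rational identities that hold after symmetrizing
over two shifts in one row (`serre_left`, `serre_right`). -/

/-! ### Elementary-matrix relations and the natural representation -/

/-- A family `E i j`, `1 ≤ i, j ≤ m`, satisfying the commutation relations of elementary matrices. -/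
def IsGLFamily {Λ : Type*} [LieRing Λ] (m : ℕ) (E : ℕ → ℕ → Λ) : Prop :=
  ∀ i j k l, 1 ≤ i → i ≤ m → 1 ≤ j → j ≤ m → 1 ≤ k → k ≤ m → 1 ≤ l → l ≤ m →
    ⁅E i j, E k l⁆ = (if j = k then E i l else 0) - (if l = i then E k j else 0)

namespace IsGLFamily

variable {Λ : Type*} [LieRing Λ] {m : ℕ} {E : ℕ → ℕ → Λ}

/-- The contragredient family. -/
theorem neg_transpose (hE : IsGLFamily m E) : IsGLFamily m fun i j => -E j i := by
  intro i j k l hi hi' hj hj' hk hk' hl hl'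
  simp only [lie_neg, neg_lie, neg_neg, hE j i l k hj hj' hi hi' hl hl' hk hk']
  simp only [eq_comm (a := k), eq_comm (a := i)]
  split_ifs <;> abel

/-- Since `E i (j+1) = ⁅E i j, E j (j+1)⁆`, the Leibniz rule carries commutation with `x` from the
superdiagonal to all higher entries. -/
theorem lie_upper_eq_zero (hE : IsGLFamily m E) {x : Λ} {p : ℕ} (hp : p ≤ m)
    (hx : ∀ j, 1 ≤ j → j + 1 ≤ p → ⁅x, E j (j + 1)⁆ = 0) {i j : ℕ} (hi : 1 ≤ i) (hij : i < j)
    (hj : j ≤ p) : ⁅x, E i j⁆ = 0 := by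
  induction j, hij using Nat.le_induction with
  | base => exact hx i hi hj
  | succ j hij ih =>
    have h := hE i j j (j + 1) hi (by omega) (by omega) (by omega) (by omega) (by omega)
      (by omega) (by omega)
    rw [if_pos rfl, if_neg (by omega), sub_zero] at h
    rw [← h, leibniz_lie, ih (by omega), hx j (by omega) hj, zero_lie, lie_zero, add_zero]

theorem lie_lower_eq_zero (hE : IsGLFamily m E) {x : Λ} {p : ℕ} (hp : p ≤ m)
    (hx : ∀ j, 1 ≤ j → j + 1 ≤ p → ⁅x, E (j + 1) j⁆ = 0) {i j : ℕ} (hj : 1 ≤ j) (hij : j < i)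
    (hi : i ≤ p) : ⁅x, E i j⁆ = 0 := by
  have := hE.neg_transpose.lie_upper_eq_zero (x := x) hp
    (fun j h1 h2 => by rw [lie_neg, hx j h1 h2, neg_zero]) hj hij hi
  rwa [lie_neg, neg_eq_zero] at this

/-- If `e` is a highest weight vector (of the weight of `E m (m + 1)`), the vectors `⁅E i m, e⁆`
span a copy of the natural representation. -/
theorem lie_natural [Module ℂ Λ] (hE : IsGLFamily m E) {e : Λ}
    (h0 : ∀ i j, 1 ≤ i → i ≤ m → 1 ≤ j → j < m → ⁅E i j, e⁆ = 0)
    (h1 : ⁅E m m, e⁆ = e)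
    (hS : ∀ p, 1 ≤ p → p + 1 = m → ⁅E p m, ⁅E p m, e⁆⁆ = 0)
    {i j k : ℕ} (hi : 1 ≤ i) (hi' : i ≤ m) (hj : 1 ≤ j) (hj' : j ≤ m) (hk : 1 ≤ k) (hk' : k ≤ m) :
    ⁅E i j, ⁅E k m, e⁆⁆ = if j = k then ⁅E i m, e⁆ else 0 := by
  have hm : 1 ≤ m := hi.trans hi'
  have hlow : ∀ i j k, 1 ≤ i → i ≤ m → 1 ≤ j → j < m → 1 ≤ k → k ≤ m →
      ⁅E i j, ⁅E k m, e⁆⁆ = if j = k then ⁅E i m, e⁆ else 0 := by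
    intro i j k hi hi' hj hj' hk hk'
    rw [leibniz_lie, h0 i j hi hi' hj hj', hE i j k m hi hi' hj hj'.le hk hk' hm le_rfl]
    have := h0 k j hk hk' hj hj'
    split_ifs <;> simp_all
  rcases hj'.lt_or_eq with hj' | rfl
  · exact hlow i j k hi hi' hj hj' hk hk'
  rcases hk'.lt_or_eq with hk' | rfl
  swap
  · rw [h1, if_pos rfl]
  rw [if_neg (by omega)]
  rcases hi'.lt_or_eq with hi' | rfl
  swap
  · rw [leibniz_lie, h1, hE _ _ k _ hi le_rfl hi le_rfl hk hk'.le hi le_rfl, if_neg (by omega),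
      if_pos rfl, zero_sub, neg_lie, neg_add_cancel]
  -- The vectors `⁅E i m, ⁅E k m, e⁆⁆` with `i, k < m` transform under `gl_{m-1}` like a tensor
  -- square, symmetric by `hsymm`. Hence the single Serre relation at `i = k = m - 1` forces all of
  -- them to vanish.
  have hZ : ∀ a b i k, 1 ≤ a → a < j → 1 ≤ b → b < j → 1 ≤ i → i < j → 1 ≤ k → k < j →
      ⁅E a b, ⁅E i j, ⁅E k j, e⁆⁆⁆ = (if b = i then ⁅E a j, ⁅E k j, e⁆⁆ else 0) +
        if b = k then ⁅E i j, ⁅E a j, e⁆⁆ else 0 := by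
    intro a b i k ha ha' hb hb' hi hi' hk hk'
    rw [leibniz_lie, hlow a b k ha ha'.le hb hb' hk hk'.le,
      hE a b i j ha ha'.le hb hb'.le hi hi'.le hj le_rfl, if_neg (by omega : ¬ j = a)]
    split_ifs <;> simp
  have hsymm : ∀ i k, 1 ≤ i → i < j → 1 ≤ k → k < j →
      ⁅E i j, ⁅E k j, e⁆⁆ = ⁅E k j, ⁅E i j, e⁆⁆ := by
    intro i k hi hi' hk hk'
    rw [leibniz_lie, hE i j k j hi hi'.le hj le_rfl hk hk'.le hj le_rfl, if_neg (by omega),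
      if_neg (by omega)]
    simp
  obtain ⟨p, rfl⟩ : ∃ p, p + 1 = j := ⟨j - 1, by omega⟩
  have hp : 1 ≤ p := by omega
  have hzero := hS p hp rfl
  have hone : ∀ a, 1 ≤ a → a < p + 1 → ⁅E a (p + 1), ⁅E p (p + 1), e⁆⁆ = 0 := by
    intro a ha ha'
    have h := hZ a p p p ha ha' hp (by omega) hp (by omega) hp (by omega)
    rw [hzero, lie_zero, if_pos rfl, if_pos rfl, hsymm p a hp (by omega) ha ha'] at h
    -- By symmetry both Leibniz terms agree, so cancelling the 2 uses the `ℂ`-module structure.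
    have h2 : (2 : ℂ) • ⁅E a (p + 1), ⁅E p (p + 1), e⁆⁆ = 0 := by rw [two_smul]; exact h.symm
    exact (smul_eq_zero.mp h2).resolve_left two_ne_zero
  rcases eq_or_ne i p with rfl | hip
  · rw [hsymm _ k hi hi' hk hk', hone k hk hk']
  · have h := hZ k p i p hk hk' hp (by omega) hi hi' hp (by omega)
    rw [hone i hi hi', lie_zero, if_neg (by omega), if_pos rfl, zero_add] at h
    exact h.symm

/-- The vectors of the natural representation commute if two of them do. -/
theorem lie_natural_natural (hE : IsGLFamily m E) {U : ℕ → Λ}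
    (hU : ∀ i j k, 1 ≤ i → i ≤ m → 1 ≤ j → j ≤ m → 1 ≤ k → k ≤ m →
      ⁅E i j, U k⁆ = if j = k then U i else 0)
    (hS : ∀ p, 1 ≤ p → p + 1 = m → ⁅U p, U m⁆ = 0)
    {i k : ℕ} (hi : 1 ≤ i) (hi' : i ≤ m) (hk : 1 ≤ k) (hk' : k ≤ m) : ⁅U i, U k⁆ = 0 := by
  have hm : 1 ≤ m := hi.trans hi'
  -- The brackets `⁅U i, U k⁆` transform like an exterior square. `E a p` first moves the vanishing
  -- of `⁅U p, U m⁆` to `⁅U a, U m⁆`, and `E k m` then moves it to `⁅U i, U k⁆`.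
  have hZ : ∀ a b i k, 1 ≤ a → a ≤ m → 1 ≤ b → b ≤ m → 1 ≤ i → i ≤ m → 1 ≤ k → k ≤ m →
      ⁅E a b, ⁅U i, U k⁆⁆ = (if b = i then ⁅U a, U k⁆ else 0) +
        if b = k then ⁅U i, U a⁆ else 0 := by
    intro a b i k ha ha' hb hb' hi hi' hk hk'
    rw [leibniz_lie, hU a b i ha ha' hb hb' hi hi', hU a b k ha ha' hb hb' hk hk']
    split_ifs <;> simp
  have hone : ∀ a, 1 ≤ a → a ≤ m → ⁅U a, U m⁆ = 0 := by
    intro a ha ha'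
    rcases ha'.lt_or_eq with ha' | rfl
    swap
    · exact lie_self _
    obtain ⟨p, rfl⟩ : ∃ p, p + 1 = m := ⟨m - 1, by omega⟩
    have h := hZ a p p (p + 1) ha ha'.le (by omega) (by omega) (by omega) (by omega) hm le_rfl
    rw [hS p (by omega) rfl, lie_zero, if_pos rfl, if_neg (by omega), add_zero] at h
    exact h.symm
  rcases eq_or_ne i m with rfl | him
  · rw [← lie_skew, hone k hk hk', neg_zero]
  · have h := hZ k m i m hk hk' hm le_rfl hi hi' hm le_rfl
    rw [hone i hi hi', lie_zero, if_neg (Ne.symm him), if_pos rfl, zero_add] at h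
    exact h.symm

end IsGLFamily

/-! ### Chevalley generators and the Serre presentation -/

/-- Chevalley generators `e k = E_{k,k+1}`, `f k = E_{k+1,k}` (`1 ≤ k < n`), `h k = E_{k,k}`
(`1 ≤ k ≤ n`) of `gl_n`, with the Serre relations. -/
structure IsGLGenerators {Λ : Type*} [LieRing Λ] (n : ℕ) (e f h : ℕ → Λ) : Prop where
  hh : ∀ p q, 1 ≤ p → p ≤ n → 1 ≤ q → q ≤ n → ⁅h p, h q⁆ = 0
  he : ∀ p k, 1 ≤ p → p ≤ n → 1 ≤ k → k < n →
    ⁅h p, e k⁆ = (if p = k then e k else 0) - if p = k + 1 then e k else 0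
  hf : ∀ p k, 1 ≤ p → p ≤ n → 1 ≤ k → k < n →
    ⁅h p, f k⁆ = (if p = k + 1 then f k else 0) - if p = k then f k else 0
  ef : ∀ k l, 1 ≤ k → k < n → 1 ≤ l → l < n →
    ⁅e k, f l⁆ = if k = l then h k - h (k + 1) else 0
  ee : ∀ k l, 1 ≤ k → k + 1 < l → l < n → ⁅e k, e l⁆ = 0
  ff : ∀ k l, 1 ≤ k → k + 1 < l → l < n → ⁅f k, f l⁆ = 0
  serre_e_lower : ∀ k, 1 ≤ k → k + 1 < n → ⁅e k, ⁅e k, e (k + 1)⁆⁆ = 0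
  serre_e_upper : ∀ k, 1 ≤ k → k + 1 < n → ⁅e (k + 1), ⁅e k, e (k + 1)⁆⁆ = 0
  serre_f_lower : ∀ k, 1 ≤ k → k + 1 < n → ⁅f k, ⁅f (k + 1), f k⁆⁆ = 0
  serre_f_upper : ∀ k, 1 ≤ k → k + 1 < n → ⁅f (k + 1), ⁅f (k + 1), f k⁆⁆ = 0

namespace IsGLGenerators

variable {Λ : Type*} [LieRing Λ] {n : ℕ} {e f h : ℕ → Λ}

/-- Change of sign of the raising operators. -/
theorem of_neg {a : ℕ → Λ}
    (hh : ∀ p q, 1 ≤ p → p ≤ n → 1 ≤ q → q ≤ n → ⁅h p, h q⁆ = 0)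
    (ha : ∀ p k, 1 ≤ p → p ≤ n → 1 ≤ k → k < n →
      ⁅h p, a k⁆ = (if p = k then a k else 0) - if p = k + 1 then a k else 0)
    (hf : ∀ p k, 1 ≤ p → p ≤ n → 1 ≤ k → k < n →
      ⁅h p, f k⁆ = (if p = k + 1 then f k else 0) - if p = k then f k else 0)
    (af : ∀ k, 1 ≤ k → k < n → ⁅a k, f k⁆ = -(h k - h (k + 1)))
    (af_ne : ∀ k l, 1 ≤ k → k < n → 1 ≤ l → l < n → k ≠ l → ⁅a k, f l⁆ = 0)
    (aa : ∀ k l, 1 ≤ k → k + 1 < l → l < n → ⁅a k, a l⁆ = 0)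
    (ff : ∀ k l, 1 ≤ k → k + 1 < l → l < n → ⁅f k, f l⁆ = 0)
    (serre_a_lower : ∀ k, 1 ≤ k → k + 1 < n → ⁅a k, ⁅a k, a (k + 1)⁆⁆ = 0)
    (serre_a_upper : ∀ k, 1 ≤ k → k + 1 < n → ⁅a (k + 1), ⁅a k, a (k + 1)⁆⁆ = 0)
    (serre_f_lower : ∀ k, 1 ≤ k → k + 1 < n → ⁅f k, ⁅f (k + 1), f k⁆⁆ = 0)
    (serre_f_upper : ∀ k, 1 ≤ k → k + 1 < n → ⁅f (k + 1), ⁅f (k + 1), f k⁆⁆ = 0) :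
    IsGLGenerators n (fun k => -a k) f h where
  hh := hh
  he p k hp hpn hk hkn := by
    rw [lie_neg, ha p k hp hpn hk hkn]
    split_ifs <;> simp
  hf := hf
  ef k l hk hkn hl hln := by
    split_ifs with hkl
    · rw [neg_lie, ← hkl, af k hk hkn, neg_neg]
    · rw [neg_lie, af_ne k l hk hkn hl hln hkl, neg_zero]
  ee k l hk hkl hln := by rw [neg_lie, lie_neg, aa k l hk hkl hln, neg_zero, neg_zero]
  ff := ff
  serre_e_lower k hk hkn := by simp [serre_a_lower k hk hkn]
  serre_e_upper k hk hkn := by simp [serre_a_upper k hk hkn]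
  serre_f_lower := serre_f_lower
  serre_f_upper := serre_f_upper

/-- The family on `1, …, m + 1` that extends `E` on `1, …, m` by the generators
`e = E_{m,m+1}`, `f = E_{m+1,m}` and `h = E_{m+1,m+1}`. -/
def extend (m : ℕ) (E : ℕ → ℕ → Λ) (e f h : Λ) (i j : ℕ) : Λ :=
  if i ≤ m then if j ≤ m then E i j else ⁅E i m, e⁆
  else if j ≤ m then ⁅f, E m j⁆ else h

/-- The bracket of the new column with the new row is not assumed: it follows from `⁅e, f⁆ = E m m -
h` by acting with `E i m` (`hUf`) and then with `E m j` (`UW`). -/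
theorem isGLFamily_extend {m : ℕ} {E : ℕ → ℕ → Λ} {e f h : Λ} (hE : IsGLFamily m E)
    (U : ∀ i j k, 1 ≤ i → i ≤ m → 1 ≤ j → j ≤ m → 1 ≤ k → k ≤ m →
      ⁅E i j, ⁅E k m, e⁆⁆ = if j = k then ⁅E i m, e⁆ else 0)
    (W : ∀ i j k, 1 ≤ i → i ≤ m → 1 ≤ j → j ≤ m → 1 ≤ k → k ≤ m →
      ⁅E i j, ⁅f, E m k⁆⁆ = -if i = k then ⁅f, E m j⁆ else 0)
    (UU : ∀ i k, 1 ≤ i → i ≤ m → 1 ≤ k → k ≤ m → ⁅⁅E i m, e⁆, ⁅E k m, e⁆⁆ = 0)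
    (WW : ∀ i k, 1 ≤ i → i ≤ m → 1 ≤ k → k ≤ m → ⁅⁅f, E m i⁆, ⁅f, E m k⁆⁆ = 0)
    (hm : 1 ≤ m) (he1 : ⁅E m m, e⁆ = e) (hf1 : ⁅f, E m m⁆ = f)
    (hef : ⁅e, f⁆ = E m m - h) (hh : ∀ i j, 1 ≤ i → i ≤ m → 1 ≤ j → j ≤ m → ⁅h, E i j⁆ = 0)
    (he : ⁅h, e⁆ = -e) (hf : ⁅h, f⁆ = f) : IsGLFamily (m + 1) (extend m E e f h) := by
  have hU : ∀ i, 1 ≤ i → i ≤ m → ⁅h, ⁅E i m, e⁆⁆ = -⁅E i m, e⁆ := by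
    intro i hi hi'
    rw [leibniz_lie, hh i m hi hi' hm le_rfl, he]
    simp
  have hW : ∀ j, 1 ≤ j → j ≤ m → ⁅h, ⁅f, E m j⁆⁆ = ⁅f, E m j⁆ := by
    intro i hi hi'
    rw [leibniz_lie, hh m i hm le_rfl hi hi', hf]
    simp
  have hUf : ∀ i, 1 ≤ i → i ≤ m → ⁅⁅E i m, e⁆, f⁆ = E i m - if i = m then h else 0 := by
    intro i hi hi'
    split_ifs with him
    · rw [him, he1, hef]
    · have h1 := W i m m hi hi' hm le_rfl hm le_rfl
      have h2 := leibniz_lie (E i m) e f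
      have h3 : ⁅E i m, h⁆ = 0 := by rw [← lie_skew, hh i m hi hi' hm le_rfl, neg_zero]
      rw [hf1, if_neg him, neg_zero] at h1
      rw [h1, lie_zero, add_zero, hef, lie_sub, h3,
        hE i m m m hi hi' hm le_rfl hm le_rfl hm le_rfl, if_pos rfl, if_neg (Ne.symm him)] at h2
      rw [← h2, sub_zero, sub_zero]
  have UW : ∀ i j, 1 ≤ i → i ≤ m → 1 ≤ j → j ≤ m →
      ⁅⁅E i m, e⁆, ⁅f, E m j⁆⁆ = E i j - if i = j then h else 0 := by
    intro i j hi hi' hj hj'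
    rcases eq_or_ne j m with rfl | hjm
    · rw [hf1, hUf i hi hi']
    have h1 := leibniz_lie (E m j) ⁅E i m, e⁆ f
    have h3 : ⁅E m j, h⁆ = 0 := by rw [← lie_skew, hh m j hm le_rfl hj hj', neg_zero]
    have h4 : ⁅⁅E i m, e⁆, ⁅E m j, f⁆⁆ = -⁅⁅E i m, e⁆, ⁅f, E m j⁆⁆ := by
      rw [← lie_skew f, lie_neg, neg_neg]
    rw [hUf i hi hi', lie_sub, hE m j i m hm le_rfl hj hj' hi hi' hm le_rfl, if_pos rfl,
      U m j i hm le_rfl hj hj' hi hi', he1, h4] at h1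
    have h5 : ⁅E m j, if i = m then h else 0⁆ = 0 := by split_ifs <;> simp [h3]
    rw [h5, sub_zero] at h1
    simp only [eq_comm (a := i)]
    split_ifs at h1 ⊢ with hji
    · rw [hef] at h1
      rw [← sub_eq_zero, ← sub_eq_zero.mpr h1]
      abel
    · rwa [zero_sub, zero_lie, zero_add, neg_inj, eq_comm, ← sub_zero (E i j)] at h1
  intro i j k l hi hi' hj hj' hk hk' hl hl'
  have hcase : ∀ {x}, x ≤ m + 1 → x ≤ m ∨ x = m + 1 := fun h => by omega
  have S1 : ¬ m + 1 ≤ m := by omega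
  have S2 : ∀ {x}, x ≤ m → x ≠ m + 1 := fun h => by omega
  have S3 : ∀ {x}, x ≤ m → m + 1 ≠ x := fun h => by omega
  have sk : ∀ x y : Λ, ⁅x, y⁆ = -⁅y, x⁆ := fun x y => (lie_skew x y).symm
  unfold extend
  rcases hcase hi' with hi' | rfl <;> rcases hcase hj' with hj' | rfl <;>
    rcases hcase hk' with hk' | rfl <;> rcases hcase hl' with hl' | rfl <;>
    simp only [if_pos hi', if_pos hj', if_pos hk', if_pos hl', if_neg S1, if_true, lie_self,
      sub_self]
  · exact hE i j k l hi hi' hj hj' hk hk' hl hl'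
  · rw [U i j k hi hi' hj hj' hk hk', if_neg (S3 hi'), sub_zero]
  · rw [W i j l hi hi' hj hj' hl hl', if_neg (S2 hj')]
    simp only [eq_comm (a := i), zero_sub]
  · rw [sk, hh i j hi hi' hj hj', if_neg (S2 hj'), if_neg (S3 hi'), neg_zero, sub_zero]
  · rw [sk, U k l i hk hk' hl hl' hi hi', if_neg (S3 hk'), zero_sub]
  · rw [UU i k hi hi' hk hk', if_neg (S3 hk'), if_neg (S3 hi'), sub_zero]
  · rw [UW i l hi hi' hl hl']
    simp only [eq_comm (a := i)]
  · rw [sk, hU i hi hi', if_neg (S3 hi'), neg_neg, sub_zero]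
  · rw [sk, W k l j hk hk' hl hl' hj hj', if_neg (S2 hl'), sub_zero, neg_neg]
    simp only [eq_comm (a := k)]
  · rw [sk, UW k j hk hk' hj hj', neg_sub]
    simp only [eq_comm (a := k)]
  · rw [WW j l hj hj' hl hl', if_neg (S2 hj'), if_neg (S2 hl'), sub_zero]
  · rw [sk, hW j hj hj', if_neg (S2 hj'), zero_sub]
  · rw [hh k l hk hk' hl hl', if_neg (S3 hk'), if_neg (S2 hl'), sub_zero]
  · rw [hU k hk hk', if_neg (S3 hk'), zero_sub]
  · rw [hW l hl hl', if_neg (S2 hl'), sub_zero]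

/-- Type `A` Serre presentation: the generators extend to a full family. -/
theorem exists_isGLFamily [Module ℂ Λ] (H : IsGLGenerators n e f h) {m : ℕ} (hm : 1 ≤ m) (hmn : m ≤ n) :
    ∃ E : ℕ → ℕ → Λ, IsGLFamily m E ∧ (∀ k, 1 ≤ k → k < m → E k (k + 1) = e k) ∧
      (∀ k, 1 ≤ k → k < m → E (k + 1) k = f k) ∧ ∀ k, 1 ≤ k → k ≤ m → E k k = h k := by
  induction m, hm using Nat.le_induction with
  | base =>
    refine ⟨fun _ _ => h 1, ?_, fun k _ _ => by omega, fun k _ _ => by omega, fun k _ _ => ?_⟩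
    · intro i j k l hi hi' hj hj' hk hk' hl hl'
      rw [lie_self, if_pos (by omega), if_pos (by omega), sub_self]
    · rw [show k = 1 by omega]
  | succ m hm ih =>
    obtain ⟨E, hE, hEe, hEf, hEh⟩ := ih (by omega)
    -- The bound `p` restricts the column index: `p = m - 1` serves `e m`, which does not commute
    -- with column `m`, and `p = m` serves `h (m + 1)`. The row version `hxE'` serves `f m`.
    have hxE : ∀ (x : Λ) (p : ℕ), p ≤ m → (∀ j, 1 ≤ j → j + 1 ≤ p → ⁅x, e j⁆ = 0) →
        (∀ j, 1 ≤ j → j ≤ p → ⁅x, h j⁆ = 0) → (∀ j, 1 ≤ j → j < m → ⁅x, f j⁆ = 0) →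
        ∀ i j, 1 ≤ i → i ≤ m → 1 ≤ j → j ≤ p → ⁅x, E i j⁆ = 0 := by
      intro x p hp h1 h2 h3 i j hi hi' hj hj'
      rcases lt_trichotomy i j with hij | rfl | hij
      · exact hE.lie_upper_eq_zero hp
          (fun j hj hj' => by rw [hEe j hj (by omega), h1 j hj hj']) hi hij hj'
      · rw [hEh i hi hi', h2 i hj hj']
      · exact hE.lie_lower_eq_zero le_rfl
          (fun j hj hj' => by rw [hEf j hj (by omega), h3 j hj (by omega)]) hj hij hi'
    have hxE' : ∀ (x : Λ) (p : ℕ), p ≤ m → (∀ j, 1 ≤ j → j + 1 ≤ p → ⁅x, f j⁆ = 0) →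
        (∀ j, 1 ≤ j → j ≤ p → ⁅x, h j⁆ = 0) → (∀ j, 1 ≤ j → j < m → ⁅x, e j⁆ = 0) →
        ∀ i j, 1 ≤ i → i ≤ p → 1 ≤ j → j ≤ m → ⁅x, E i j⁆ = 0 := by
      intro x p hp h1 h2 h3 i j hi hi' hj hj'
      rcases lt_trichotomy i j with hij | rfl | hij
      · exact hE.lie_upper_eq_zero le_rfl
          (fun j hj hj' => by rw [hEe j hj (by omega), h3 j hj (by omega)]) hi hij hj'
      · rw [hEh i hi hj', h2 i hi hi']
      · exact hE.lie_lower_eq_zero hp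
          (fun j hj hj' => by rw [hEf j hj (by omega), h1 j hj hj']) hj hij hi'
    have sk : ∀ x y : Λ, ⁅x, y⁆ = -⁅y, x⁆ := fun x y => (lie_skew x y).symm
    have he0 : ∀ i j, 1 ≤ i → i ≤ m → 1 ≤ j → j < m → ⁅E i j, e m⁆ = 0 := by
      intro i j hi hi' hj hj'
      rw [sk, hxE (e m) (m - 1) (by omega) ?_ ?_ ?_ i j hi hi' hj (by omega), neg_zero]
      · intro a ha ha'
        rw [sk, H.ee a m ha (by omega) hmn, neg_zero]
      · intro a ha ha'
        rw [sk, H.he a m ha (by omega) hm hmn, if_neg (by omega), if_neg (by omega)]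
        simp
      · intro a ha ha'
        rw [H.ef m a hm hmn ha (by omega), if_neg (by omega)]
    have hf0 : ∀ i j, 1 ≤ i → i < m → 1 ≤ j → j ≤ m → ⁅E i j, f m⁆ = 0 := by
      intro i j hi hi' hj hj'
      rw [sk, hxE' (f m) (m - 1) (by omega) ?_ ?_ ?_ i j hi (by omega) hj hj', neg_zero]
      · intro a ha ha'
        rw [sk, H.ff a m ha (by omega) hmn, neg_zero]
      · intro a ha ha'
        rw [sk, H.hf a m ha (by omega) hm hmn, if_neg (by omega), if_neg (by omega)]
        simp
      · intro a ha ha'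
        rw [sk, H.ef a m ha (by omega) hm hmn, if_neg (by omega), neg_zero]
    have he1 : ⁅E m m, e m⁆ = e m := by
      rw [hEh m hm le_rfl, H.he m m hm (by omega) hm hmn]
      simp
    have hf1 : ⁅f m, E m m⁆ = f m := by
      rw [sk, hEh m hm le_rfl, H.hf m m hm (by omega) hm hmn]
      simp
    have hU : ∀ i j k, 1 ≤ i → i ≤ m → 1 ≤ j → j ≤ m → 1 ≤ k → k ≤ m →
        ⁅E i j, ⁅E k m, e m⁆⁆ = if j = k then ⁅E i m, e m⁆ else 0 := by
      intro i j k hi hi' hj hj' hk hk'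
      refine hE.lie_natural he0 he1 ?_ hi hi' hj hj' hk hk'
      rintro p hp rfl
      rw [hEe p hp (by omega)]
      exact H.serre_e_lower p hp hmn
    have hneg : ∀ k, ⁅-E m k, f m⁆ = ⁅f m, E m k⁆ := fun k => by rw [neg_lie, lie_skew]
    -- Negative transposition exchanges the new row with the new column, so `f m` plays the part of
    -- `e m` for the contragredient family.
    have hW' : ∀ i j k, 1 ≤ i → i ≤ m → 1 ≤ j → j ≤ m → 1 ≤ k → k ≤ m →
        ⁅-E j i, ⁅f m, E m k⁆⁆ = if j = k then ⁅f m, E m i⁆ else 0 := by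
      intro i j k hi hi' hj hj' hk hk'
      rw [← hneg, ← hneg]
      refine hE.neg_transpose.lie_natural (e := f m) ?_ ?_ ?_ hi hi' hj hj' hk hk'
      · intro i j hi hi' hj hj'
        rw [neg_lie, hf0 j i hj hj' hi hi', neg_zero]
      · rw [hneg, hf1]
      · rintro p hp rfl
        rw [hneg, hEf p hp (by omega), neg_lie, H.serre_f_lower p hp hmn, neg_zero]
    refine ⟨extend m E (e m) (f m) (h (m + 1)), isGLFamily_extend hE hU ?_ ?_ ?_ hm he1 hf1 ?_ ?_
      ?_ ?_, ?_, ?_, ?_⟩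
    · intro i j k hi hi' hj hj' hk hk'
      rw [← hW' j i k hj hj' hi hi' hk hk', neg_lie, neg_neg]
    · intro i k hi hi' hk hk'
      refine hE.lie_natural_natural (U := fun i => ⁅E i m, e m⁆) hU ?_ hi hi' hk hk'
      rintro p hp rfl
      simp only [he1]
      rw [hEe p hp (by omega), sk, H.serre_e_upper p hp hmn, neg_zero]
    · intro i k hi hi' hk hk'
      refine hE.neg_transpose.lie_natural_natural (U := fun i => ⁅f m, E m i⁆) hW' ?_ hi hi' hk hk'
      rintro p hp rfl
      simp only [hf1]
      rw [hEf p hp (by omega), sk, H.serre_f_upper p hp hmn, neg_zero]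
    · rw [H.ef m m hm hmn hm hmn, if_pos rfl, hEh m hm le_rfl]
    · intro i j hi hi' hj hj'
      refine hxE _ m le_rfl ?_ ?_ ?_ i j hi hi' hj hj'
      · intro a ha ha'
        rw [H.he _ a (by omega) hmn ha (by omega), if_neg (by omega), if_neg (by omega), sub_zero]
      · intro a ha ha'
        exact H.hh _ _ (by omega) hmn ha (by omega)
      · intro a ha ha'
        rw [H.hf _ a (by omega) hmn ha (by omega), if_neg (by omega), if_neg (by omega), sub_zero]
    · rw [H.he _ m (by omega) hmn hm hmn, if_neg (by omega), if_pos rfl, zero_sub]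
    · rw [H.hf _ m (by omega) hmn hm hmn, if_neg (by omega : ¬ m + 1 = m), if_pos rfl, sub_zero]
    · intro k hk hk'
      rcases (Nat.lt_succ_iff.mp hk').lt_or_eq with hk' | rfl
      · rw [extend, if_pos hk'.le, if_pos (by omega), hEe k hk hk']
      · rw [extend, if_pos le_rfl, if_neg (by omega), he1]
    · intro k hk hk'
      rcases (Nat.lt_succ_iff.mp hk').lt_or_eq with hk' | rfl
      · rw [extend, if_pos (by omega), if_pos hk'.le, hEf k hk hk']
      · rw [extend, if_neg (by omega), if_pos le_rfl, hf1]
    · intro k hk hk'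
      rcases hk'.lt_or_eq with hk' | rfl
      · rw [extend, if_pos (by omega), if_pos (by omega), hEh k hk (by omega)]
      · rw [extend, if_neg (by omega), if_neg (by omega)]

end IsGLGenerators

/-! ### A residue identity from Lagrange interpolation -/

open Polynomial in
/-- Sum of the residues of `P(t) Q(t + 1) / (N(t) N(t + 1))`, where `P`, `Q`, `N` are monic with
roots `y`, `z`, `x`. -/
theorem sum_residues_shifted {I J K : Finset ℕ} (x y z : ℕ → ℂ)
    (hx : ∀ i ∈ I, ∀ j ∈ I, i ≠ j → x i ≠ x j) (hx' : ∀ i ∈ I, ∀ j ∈ I, i ≠ j → x i ≠ x j - 1)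
    (hJ : J.card = I.card + 1) (hK : K.card + 1 = I.card) :
    ∑ i ∈ I, ((∏ j ∈ J, (x i - y j)) * (∏ j ∈ K, (x i + 1 - z j)) /
        ((∏ j ∈ I.erase i, (x i - x j)) * ∏ j ∈ I.erase i, (x i + 1 - x j)) -
      (∏ j ∈ J, (x i - 1 - y j)) * (∏ j ∈ K, (x i - z j)) /
        ((∏ j ∈ I.erase i, (x i - 1 - x j)) * ∏ j ∈ I.erase i, (x i - x j))) =
      2 * ∑ i ∈ I, x i - ∑ j ∈ J, y j - ∑ j ∈ K, z j - 1 := by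
  classical
  set s : Finset (ℕ ⊕ ℕ) := I.disjSum I with hs
  set v : ℕ ⊕ ℕ → ℂ := Sum.elim x fun i => x i - 1 with hv
  have hcard : s.card = I.card + I.card := Finset.card_disjSum I I
  have hvs : Set.InjOn v s := by
    rintro (i | i) hi (j | j) hj h <;> simp only [hs, Finset.mem_coe, Finset.inl_mem_disjSum,
      Finset.inr_mem_disjSum] at hi hj <;> simp only [hv, Sum.elim_inl, Sum.elim_inr] at h
    · by_contra hij
      exact hx i hi j hj (fun h => hij (by rw [h])) h
    · by_cases hij : i = j
      · rw [hij] at h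
        norm_num [eq_sub_iff_add_eq] at h
      · exact absurd h (hx' i hi j hj hij)
    · by_cases hij : i = j
      · rw [hij] at h
        norm_num [sub_eq_iff_eq_add] at h
      · exact absurd h.symm (hx' j hj i hi (Ne.symm hij))
    · by_contra hij
      exact hx i hi j hj (fun h => hij (by rw [h])) (sub_left_injective h)
  set P : ℂ[X] := ∏ j ∈ J, (X - C (y j)) with hP
  set Q : ℂ[X] := ∏ j ∈ K, (X - C (z j - 1)) with hQ
  set M : ℂ[X] := ∏ a ∈ s, (X - C (v a)) with hM
  have hPm : P.Monic := monic_prod_X_sub_C _ _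
  have hQm : Q.Monic := monic_prod_X_sub_C _ _
  have hMm : M.Monic := monic_prod_X_sub_C _ _
  have hPd : P.natDegree = J.card := natDegree_finsetProd_X_sub_C_eq_card _ _
  have hQd : Q.natDegree = K.card := natDegree_finsetProd_X_sub_C_eq_card _ _
  have hMd : M.natDegree = s.card := natDegree_finsetProd_X_sub_C_eq_card _ _
  have hPQd : (P * Q).natDegree = s.card := by
    rw [hPm.natDegree_mul hQm, hPd, hQd]; omega
  -- `P * Q` and `M` are monic of the same degree. Subtracting `M` lowers the degree enough for
  -- interpolation at the roots of `M` without changing the values there.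
  have hdeg : (P * Q - M).degree < s.card := by
    have : (P * Q).degree = s.card := by
      rw [degree_eq_natDegree (hPm.mul hQm).ne_zero, hPQd]
    rw [← this]
    refine degree_sub_lt_left ?_ (hPm.mul hQm).ne_zero ?_
    · rw [this, degree_eq_natDegree hMm.ne_zero, hMd]
    · rw [(hPm.mul hQm).leadingCoeff, hMm.leadingCoeff]
  have key := Lagrange.coeff_eq_sum hvs hdeg
  -- The constant `-1` is `|K| - |I|`, produced by the unit shifts in the roots `z j - 1` and `x i -
  -- 1`.
  have hc : (P * Q - M).coeff (s.card - 1) =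
      2 * ∑ i ∈ I, x i - ∑ j ∈ J, y j - ∑ j ∈ K, z j - 1 := by
    rw [coeff_sub]
    nth_rewrite 1 [← hPQd]
    rw [← hMd, ← nextCoeff_of_natDegree_pos (by omega), ← nextCoeff_of_natDegree_pos (by omega),
      hPm.nextCoeff_mul hQm, hP, hQ, hM, prod_X_sub_C_nextCoeff, prod_X_sub_C_nextCoeff,
      prod_X_sub_C_nextCoeff, hs, Finset.sum_disjSum]
    simp only [hv, Sum.elim_inl, Sum.elim_inr, Finset.sum_sub_distrib, Finset.sum_const,
      nsmul_eq_mul, mul_one]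
    rw [← hK]
    push_cast
    ring
  rw [← hc, key, hs, Finset.sum_disjSum, ← Finset.sum_add_distrib]
  refine Finset.sum_congr rfl fun i hi => ?_
  have hM0 : ∀ a ∈ s, M.eval (v a) = 0 := fun a ha => by
    rw [hM, eval_prod]
    exact Finset.prod_eq_zero ha (by simp)
  have hi1 : Sum.inl i ∈ s := by rw [hs, Finset.inl_mem_disjSum]; exact hi
  have hi2 : Sum.inr i ∈ s := by rw [hs, Finset.inr_mem_disjSum]; exact hi
  have e1 : (I.disjSum I).erase (Sum.inl i) = (I.erase i).disjSum I := by
    ext (a | a) <;> simp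
  have e2 : (I.disjSum I).erase (Sum.inr i) = I.disjSum (I.erase i) := by
    ext (a | a) <;> simp
  rw [eval_sub, hM0 _ hi1, eval_sub, hM0 _ hi2, e1, e2, Finset.prod_disjSum, Finset.prod_disjSum]
  simp only [hv, Sum.elim_inl, Sum.elim_inr, hP, hQ, eval_mul, eval_prod, eval_sub, eval_X, eval_C,
    sub_zero]
  -- The nodes `x i` and `x i - 1` face each other with difference `1` or `-1`; the latter gives the
  -- minus sign in the statement.
  rw [← Finset.mul_prod_erase I _ hi, ← Finset.mul_prod_erase I (fun j => x i - 1 - x j) hi]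
  have f1 : ∀ j, x i - (z j - 1) = x i + 1 - z j := fun j => by ring
  have f2 : ∀ j, x i - 1 - (z j - 1) = x i - z j := fun j => by ring
  have f3 : ∀ j, x i - (x j - 1) = x i + 1 - x j := fun j => by ring
  have f4 : ∀ j, x i - 1 - (x j - 1) = x i - x j := fun j => by ring
  have f5 : x i - 1 - x i = -1 := by ring
  have f6 : x i + 1 - x i = 1 := by ring
  simp only [f6, f1, f2, f3, f4, f5, one_mul, neg_mul, div_neg]
  rw [sub_eq_add_neg]

/-! ### Weighted shift operators and their commutators -/

/-- The operator on formal linear combinations of states that sends `s` to `a s • σ s`. -/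
noncomputable def weightedShift {S : Type*} (a : S → ℂ) (σ : S → S) : Module.End ℂ (S →₀ ℂ) :=
  Finsupp.linearCombination ℂ fun s => Finsupp.single (σ s) (a s)

section WeightedShift

variable {S : Type*}

theorem weightedShift_single (a : S → ℂ) (σ : S → S) (s : S) :
    weightedShift a σ (Finsupp.single s 1) = Finsupp.single (σ s) (a s) := by
  simp [weightedShift]

theorem weightedShift_mul (a b : S → ℂ) (σ τ : S → S) :
    weightedShift a σ * weightedShift b τ = weightedShift (fun s => b s * a (τ s)) (σ ∘ τ) := by
  refine Finsupp.lhom_ext' fun s => LinearMap.ext_ring ?_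
  simp [weightedShift]

theorem weightedShift_sub (a b : S → ℂ) (σ : S → S) :
    weightedShift a σ - weightedShift b σ = weightedShift (fun s => a s - b s) σ := by
  refine Finsupp.lhom_ext' fun s => LinearMap.ext_ring ?_
  simp [weightedShift]

theorem weightedShift_neg (a : S → ℂ) (σ : S → S) :
    -weightedShift a σ = weightedShift (fun s => -a s) σ := by
  refine Finsupp.lhom_ext' fun s => LinearMap.ext_ring ?_
  simp [weightedShift]

theorem weightedShift_zero (σ : S → S) : weightedShift (fun _ => 0) σ = 0 := by
  refine Finsupp.lhom_ext' fun s => LinearMap.ext_ring ?_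
  simp [weightedShift]

theorem weightedShift_sum {ι : Type*} (I : Finset ι) (a : ι → S → ℂ) (σ : S → S) :
    ∑ i ∈ I, weightedShift (a i) σ = weightedShift (fun s => ∑ i ∈ I, a i s) σ := by
  refine Finsupp.lhom_ext' fun s => LinearMap.ext_ring ?_
  simp [weightedShift, Finsupp.single_finsetSum]

theorem commutator_weightedShift (a b : S → ℂ) {σ τ : S → S} (h : ∀ s, σ (τ s) = τ (σ s)) :
    weightedShift a σ * weightedShift b τ - weightedShift b τ * weightedShift a σ =
      weightedShift (fun s => b s * a (τ s) - a s * b (σ s)) (σ ∘ τ) := by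
  rw [weightedShift_mul, weightedShift_mul, ← weightedShift_sub,
    show τ ∘ σ = σ ∘ τ from funext fun s => (h s).symm]

theorem commutator_weightedShift_eq_zero {a b : S → ℂ} {σ τ : S → S}
    (h : ∀ s, σ (τ s) = τ (σ s)) (hab : ∀ s, b s * a (τ s) = a s * b (σ s)) :
    weightedShift a σ * weightedShift b τ - weightedShift b τ * weightedShift a σ = 0 := by
  rw [commutator_weightedShift a b h, ← weightedShift_zero (σ ∘ τ)]
  simp only [hab, sub_self]

end WeightedShift

theorem Finset.commutator_sum_sum {A ι κ : Type*} [Ring A] (I : Finset ι) (J : Finset κ)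
    (f : ι → A) (g : κ → A) : (∑ i ∈ I, f i) * (∑ j ∈ J, g j) - (∑ j ∈ J, g j) * (∑ i ∈ I, f i) =
      ∑ i ∈ I, ∑ j ∈ J, (f i * g j - g j * f i) := by
  simp only [Finset.sum_sub_distrib, Finset.sum_mul_sum]
  rw [Finset.sum_comm (s := J)]

theorem Finset.commutator_sum {A κ : Type*} [Ring A] (a : A) (J : Finset κ) (g : κ → A) :
    a * (∑ j ∈ J, g j) - (∑ j ∈ J, g j) * a = ∑ j ∈ J, (a * g j - g j * a) := by
  rw [Finset.sum_sub_distrib, Finset.mul_sum, Finset.sum_mul]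

theorem Module.End.commutator_sum_sum {M ι κ : Type*} [AddCommGroup M] [Module ℂ M]
    (I : Finset ι) (J : Finset κ) (f : ι → Module.End ℂ M) (g : κ → Module.End ℂ M) :
    (∑ i ∈ I, f i) * (∑ j ∈ J, g j) - (∑ j ∈ J, g j) * (∑ i ∈ I, f i) =
      ∑ i ∈ I, ∑ j ∈ J, (f i * g j - g j * f i) :=
  Finset.commutator_sum_sum I J f g

theorem Module.End.commutator_sum {M κ : Type*} [AddCommGroup M] [Module ℂ M]
    (a : Module.End ℂ M) (J : Finset κ) (g : κ → Module.End ℂ M) :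
    a * (∑ j ∈ J, g j) - (∑ j ∈ J, g j) * a = ∑ j ∈ J, (a * g j - g j * a) :=
  Finset.commutator_sum a J g

theorem Finset.sum_sum_eq_zero_of_antisymm {M ι : Type*} [AddCommGroup M] [Module ℂ M]
    {I : Finset ι} {F : ι → ι → M} (hF : ∀ i ∈ I, ∀ j ∈ I, F i j + F j i = 0) :
    ∑ i ∈ I, ∑ j ∈ I, F i j = 0 := by
  have h : (2 : ℂ) • ∑ i ∈ I, ∑ j ∈ I, F i j = 0 := by
    rw [two_smul]
    nth_rewrite 2 [Finset.sum_comm]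
    simp only [← Finset.sum_add_distrib]
    exact Finset.sum_eq_zero fun i hi => Finset.sum_eq_zero fun j hj => hF i hi j hj
  exact (smul_eq_zero.mp h).resolve_left two_ne_zero

/-- The terms for `(i, j)` and `(j, i)` shift to the same state, so coefficients need cancel only
after symmetrization. The Serre relations take this form. -/
theorem sum_sum_weightedShift_eq_zero {S ι : Type*} {I : Finset ι} {a : ι → ι → S → ℂ}
    {σ : ι → ι → S → S} (hσ : ∀ i j s, σ i j s = σ j i s)
    (ha : ∀ i ∈ I, ∀ j ∈ I, ∀ s, a i j s + a j i s = 0) :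
    ∑ i ∈ I, ∑ j ∈ I, weightedShift (a i j) (σ i j) = 0 := by
  refine Finsupp.lhom_ext' fun s => LinearMap.ext_ring ?_
  simp only [LinearMap.coe_comp, Function.comp_apply, Finsupp.lsingle_apply, LinearMap.sum_apply,
    weightedShift_single, LinearMap.zero_apply]
  refine Finset.sum_sum_eq_zero_of_antisymm fun i hi j hj => ?_
  rw [hσ i j, ← Finsupp.single_add, ha i hi j hj, Finsupp.single_zero]

/-! ### Adjacent rows and the Serre relations -/

/-- Two finite rows of coordinates `x i`, `y j` on a set of states, with maps `u i`, `v j` that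
shift a single coordinate by `ε`. -/
structure ShiftedRows {S : Type*} (I J : Finset ℕ) (x y : ℕ → S → ℂ) (u v : ℕ → S → S)
    (ε : ℂ) : Prop where
  xu : ∀ i ∈ I, ∀ i' ∈ I, ∀ s, x i (u i' s) = x i s + if i = i' then ε else 0
  yv : ∀ j ∈ J, ∀ j' ∈ J, ∀ s, y j (v j' s) = y j s + if j = j' then ε else 0
  xv : ∀ i ∈ I, ∀ j ∈ J, ∀ s, x i (v j s) = x i s
  yu : ∀ i ∈ I, ∀ j ∈ J, ∀ s, y j (u i s) = y j s
  uu : ∀ i i' s, u i (u i' s) = u i' (u i s)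
  vv : ∀ j j' s, v j (v j' s) = v j' (v j s)
  uv : ∀ i j s, u i (v j s) = v j (u i s)
  hx : ∀ i ∈ I, ∀ i' ∈ I, i ≠ i' → ∀ s, x i s ≠ x i' s
  hy : ∀ j ∈ J, ∀ j' ∈ J, j ≠ j' → ∀ s, y j s ≠ y j' s

/-- The coefficient of the shift of `x i`. -/
noncomputable def rowCoeff {S : Type*} (I J : Finset ℕ) (x y : ℕ → S → ℂ) (i : ℕ) (s : S) : ℂ :=
  (∏ j ∈ J, (x i s - y j s)) / ∏ i' ∈ I.erase i, (x i s - x i' s)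

theorem rowCoeff_erase {S : Type*} (I : Finset ℕ) {J : Finset ℕ} (x y : ℕ → S → ℂ) (i : ℕ) {j : ℕ}
    (hj : j ∈ J) (s : S) :
    rowCoeff I J x y i s = (x i s - y j s) * rowCoeff I (J.erase j) x y i s := by
  rw [rowCoeff, rowCoeff, ← Finset.mul_prod_erase J _ hj, mul_div_assoc]

theorem rowCoeff_congr {S : Type*} {I J : Finset ℕ} {x y : ℕ → S → ℂ} {i : ℕ} {s s' : S}
    (hx : ∀ k ∈ I, x k s' = x k s) (hy : ∀ k ∈ J, y k s' = y k s) (hi : i ∈ I) :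
    rowCoeff I J x y i s' = rowCoeff I J x y i s := by
  simp only [rowCoeff]
  congr 1
  · exact Finset.prod_congr rfl fun k hk => by rw [hx i hi, hy k hk]
  · exact Finset.prod_congr rfl fun k hk => by rw [hx i hi, hx k (Finset.mem_of_mem_erase hk)]

/-- Only the denominator factor `x i - x i'` changes, to `x i - x i' - ε`. If the latter is zero,
both sides are zero by the convention on division. -/
theorem rowCoeff_shift {S : Type*} {I K : Finset ℕ} {x y : ℕ → S → ℂ} {i i' : ℕ} {s s' : S} {ε : ℂ}
    (hx : ∀ k ∈ I, x k s' = x k s + if k = i' then ε else 0) (hy : ∀ k ∈ K, y k s' = y k s)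
    (hi : i ∈ I) (hi' : i' ∈ I) (h : i ≠ i') (hne : x i s ≠ x i' s) :
    rowCoeff I K x y i s' =
      rowCoeff I K x y i s * ((x i s - x i' s) / (x i s - x i' s - ε)) := by
  have e1 : ∏ k ∈ K, (x i s' - y k s') = ∏ k ∈ K, (x i s - y k s) :=
    Finset.prod_congr rfl fun k hk => by rw [hx i hi, hy k hk, if_neg h, add_zero]
  have e2 : ∏ k ∈ (I.erase i).erase i', (x i s' - x k s') =
      ∏ k ∈ (I.erase i).erase i', (x i s - x k s) :=
    Finset.prod_congr rfl fun k hk => by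
      rw [hx i hi, hx k (Finset.mem_of_mem_erase (Finset.mem_of_mem_erase hk)),
        if_neg h, if_neg (Finset.ne_of_mem_erase hk), add_zero, add_zero]
  have h1 : i' ∈ I.erase i := Finset.mem_erase.mpr ⟨h.symm, hi'⟩
  rw [rowCoeff, rowCoeff, ← Finset.mul_prod_erase _ _ h1, ← Finset.mul_prod_erase _ _ h1, e1, e2,
    hx i hi, hx i' hi', if_neg h, if_pos rfl, add_zero, ← sub_sub,
    div_mul_div_comm, mul_comm _ (x i s - x i' s), mul_assoc,
    mul_comm (∏ k ∈ (I.erase i).erase i', (x i s - x k s)),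
    mul_div_mul_left _ _ (sub_ne_zero.mpr hne)]

/-- The operator `∑ i, a_i u_i`. -/
noncomputable def rowOp {S : Type*} (I : Finset ℕ) (a : ℕ → S → ℂ) (u : ℕ → S → S) :
    Module.End ℂ (S →₀ ℂ) :=
  ∑ i ∈ I, weightedShift (a i) (u i)

namespace ShiftedRows

variable {S : Type*} {I J : Finset ℕ} {x y : ℕ → S → ℂ} {u v : ℕ → S → S} {ε : ℂ}

theorem rowCoeff_v_of_subset (H : ShiftedRows I J x y u v ε) {K : Finset ℕ} (hK : K ⊆ J) {i j : ℕ}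
    (hi : i ∈ I) (hj : j ∈ J) (hjK : j ∉ K) (s : S) :
    rowCoeff I K x y i (v j s) = rowCoeff I K x y i s := by
  simp only [rowCoeff]
  congr 1
  · refine Finset.prod_congr rfl fun k hk => ?_
    rw [H.xv i hi j hj, H.yv k (hK hk) j hj, if_neg (by rintro rfl; exact hjK hk), add_zero]
  · refine Finset.prod_congr rfl fun k hk => ?_
    rw [H.xv i hi j hj, H.xv k (Finset.mem_of_mem_erase hk) j hj]

/-- Distinctness is assumed at every state; evaluating it after the shift `u i'` yields the new
nonvanishing. -/
theorem x_sub_ne (H : ShiftedRows I J x y u v ε) {i i' : ℕ} (hi : i ∈ I) (hi' : i' ∈ I)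
    (h : i ≠ i') (s : S) : x i s - x i' s - ε ≠ 0 := by
  have := H.hx i hi i' hi' h (u i' s)
  rw [H.xu i hi i' hi', H.xu i' hi' i' hi', if_neg h, if_pos rfl] at this
  intro h0
  exact this (by linear_combination h0)

theorem y_sub_ne (H : ShiftedRows I J x y u v ε) {i i' : ℕ} (hi : i ∈ J) (hi' : i' ∈ J)
    (h : i ≠ i') (s : S) : y i s - y i' s - ε ≠ 0 := by
  have := H.hy i hi i' hi' h (v i' s)
  rw [H.yv i hi i' hi', H.yv i' hi' i' hi', if_neg h, if_pos rfl] at this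
  intro h0
  exact this (by linear_combination h0)

theorem rowCoeff_u (H : ShiftedRows I J x y u v ε) {K : Finset ℕ} (hK : K ⊆ J) {i i' : ℕ}
    (hi : i ∈ I) (hi' : i' ∈ I) (h : i ≠ i') (s : S) :
    rowCoeff I K x y i (u i' s) =
      rowCoeff I K x y i s * ((x i s - x i' s) / (x i s - x i' s - ε)) :=
  rowCoeff_shift (fun k hk => H.xu k hk i' hi' s) (fun k hk => H.yu i' hi' k (hK hk) s) hi hi' h
    (H.hx i hi i' hi' h s)

/-- Coefficients for the second row whose numerators do not see the first row. -/
structure IsOuterCoeff (I J : Finset ℕ) (y : ℕ → S → ℂ) (u v : ℕ → S → S) (ε : ℂ)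
    (b : ℕ → S → ℂ) : Prop where
  bu : ∀ i ∈ I, ∀ j ∈ J, ∀ s, b j (u i s) = b j s
  bv : ∀ j ∈ J, ∀ j' ∈ J, j ≠ j' → ∀ s,
    b j (v j' s) = b j s * ((y j s - y j' s) / (y j s - y j' s - ε))

/-- The `i`-th inner coefficient is affine in `y j`, with the factor `x i - y j`; shifting `y j` by
`ε` changes that factor by `-ε`, while `b j` ignores the shift `u i`. -/
theorem commutator_rowOp (H : ShiftedRows I J x y u v ε) {b : ℕ → S → ℂ}
    (hb : IsOuterCoeff I J y u v ε b) :
    rowOp I (rowCoeff I J x y) u * rowOp J b v - rowOp J b v * rowOp I (rowCoeff I J x y) u =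
      ∑ i ∈ I, ∑ j ∈ J, weightedShift (fun s => -ε * (rowCoeff I (J.erase j) x y i s * b j s))
        (u i ∘ v j) := by
  rw [rowOp, rowOp, Module.End.commutator_sum_sum]
  refine Finset.sum_congr rfl fun i hi => Finset.sum_congr rfl fun j hj => ?_
  rw [commutator_weightedShift _ _ (H.uv i j)]
  congr 1
  funext s
  rw [rowCoeff_erase I x y i hj, rowCoeff_erase I x y i hj, hb.bu i hi j hj, H.xv i hi j hj,
    H.yv j hj j hj, if_pos rfl,
    H.rowCoeff_v_of_subset (Finset.erase_subset j J) hi hj (Finset.notMem_erase j J)]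
  ring

theorem serre_left (H : ShiftedRows I J x y u v ε) {b : ℕ → S → ℂ}
    (hb : IsOuterCoeff I J y u v ε b) {A C : Module.End ℂ (S →₀ ℂ)}
    (hA : A = rowOp I (rowCoeff I J x y) u) (hC : C = A * rowOp J b v - rowOp J b v * A) :
    A * C - C * A = 0 := by
  rw [hA, H.commutator_rowOp hb, Finset.sum_comm] at hC
  rw [hC, hA, rowOp, Module.End.commutator_sum_sum, Finset.sum_comm]
  refine Finset.sum_eq_zero fun j hj => ?_
  simp only [Module.End.commutator_sum]
  have hcomm : ∀ i i' s, u i' ((u i ∘ v j) s) = (u i ∘ v j) (u i' s) := fun i i' s => by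
    simp only [Function.comp_apply, H.uu i' i, H.uv]
  refine (Finset.sum_congr rfl fun i' _ => Finset.sum_congr rfl fun i _ =>
    commutator_weightedShift _ _ (hcomm i i')).trans ?_
  refine sum_sum_weightedShift_eq_zero (fun i i' s => H.uu _ _ _) fun i' hi' i hi s => ?_
  have hsub := Finset.erase_subset j J
  simp only [Function.comp_apply]
  rw [rowCoeff_erase I x y i' hj, rowCoeff_erase I x y i hj, rowCoeff_erase I x y i' hj s,
    rowCoeff_erase I x y i hj s, H.uv, H.uv,
    H.rowCoeff_v_of_subset hsub hi hj (Finset.notMem_erase j J),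
    H.rowCoeff_v_of_subset hsub hi' hj (Finset.notMem_erase j J), hb.bu i hi j hj,
    hb.bu i' hi' j hj, H.xv i hi j hj, H.xv i' hi' j hj, H.xu i' hi' i hi, H.xu i hi i' hi',
    H.yv j hj j hj, H.yv j hj j hj, H.yu i hi j hj, H.yu i' hi' j hj, if_pos rfl]
  -- For `i = i'` the coefficient vanishes by itself, because `u i` and `v j` together preserve `x i
  -- - y j`. For `i ≠ i'` only the symmetrized sum vanishes.
  rcases eq_or_ne i i' with rfl | hii
  · rw [if_pos rfl]
    ring
  · rw [if_neg hii, if_neg hii.symm, H.rowCoeff_u hsub hi hi' hii, H.rowCoeff_u hsub hi' hi hii.symm]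
    have h1 := H.x_sub_ne hi hi' hii s
    have h2 := H.x_sub_ne hi' hi hii.symm s
    field_simp
    ring

theorem serre_right (H : ShiftedRows I J x y u v ε) {b : ℕ → S → ℂ}
    (hb : IsOuterCoeff I J y u v ε b) {B C : Module.End ℂ (S →₀ ℂ)}
    (hB : B = rowOp J b v)
    (hC : C = rowOp I (rowCoeff I J x y) u * B - B * rowOp I (rowCoeff I J x y) u) :
    B * C - C * B = 0 := by
  rw [hB, H.commutator_rowOp hb] at hC
  rw [hC, hB, rowOp, Module.End.commutator_sum_sum, Finset.sum_comm]
  refine Finset.sum_eq_zero fun i hi => ?_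
  simp only [Module.End.commutator_sum]
  have hcomm : ∀ j j' s, v j' ((u i ∘ v j) s) = (u i ∘ v j) (v j' s) := fun j j' s => by
    simp only [Function.comp_apply, ← H.uv, H.vv j' j]
  refine (Finset.sum_congr rfl fun j' _ => Finset.sum_congr rfl fun j _ =>
    commutator_weightedShift _ _ (hcomm j j')).trans ?_
  refine sum_sum_weightedShift_eq_zero (fun j j' s => by
    simp only [Function.comp_apply, ← H.uv, H.vv j j']) fun j' hj' j hj s => ?_
  simp only [Function.comp_apply]
  rw [hb.bu i hi j' hj', hb.bu i hi j hj]
  rcases eq_or_ne j j' with rfl | hjj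
  · rw [H.rowCoeff_v_of_subset (Finset.erase_subset j J) hi hj (Finset.notMem_erase j J)]
    ring
  -- Both factors `x i - y j` and `x i - y j'` are split off, so what remains of the inner
  -- coefficient is unaffected by either shift.
  · have hm : j' ∈ J.erase j := Finset.mem_erase.mpr ⟨hjj.symm, hj'⟩
    have hm' : j ∈ J.erase j' := Finset.mem_erase.mpr ⟨hjj, hj⟩
    have hsub : (J.erase j).erase j' ⊆ J :=
      (Finset.erase_subset _ _).trans (Finset.erase_subset _ _)
    have h1 := H.y_sub_ne hj hj' hjj s
    have h2 := H.y_sub_ne hj' hj hjj.symm s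
    rw [rowCoeff_erase I x y i hm s, rowCoeff_erase I x y i hm' s,
      rowCoeff_erase I x y i hm (v j' s), rowCoeff_erase I x y i hm' (v j s), Finset.erase_right_comm (a := j'),
      H.rowCoeff_v_of_subset hsub hi hj (by simp), H.rowCoeff_v_of_subset hsub hi hj' (by simp),
      H.xv i hi j hj, H.xv i hi j' hj', H.yv j hj j hj, H.yv j' hj' j' hj', if_pos rfl, if_pos rfl,
      hb.bv j hj j' hj' hjj, hb.bv j' hj' j hj hjj.symm]
    field_simp
    ring

end ShiftedRows

/-! ### Raising against lowering on one row -/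

/-- The commutator of a raising and a lowering operator on the same row `x`. -/
theorem commutator_raising_lowering {S : Type*} {I J K : Finset ℕ} {x y z : ℕ → S → ℂ}
    {u w : ℕ → S → S} (hJ : J.card = I.card + 1) (hK : K.card + 1 = I.card)
    (hxu : ∀ i ∈ I, ∀ i' ∈ I, ∀ s, x i (u i' s) = x i s + if i = i' then 1 else 0)
    (hxw : ∀ i ∈ I, ∀ i' ∈ I, ∀ s, x i (w i' s) = x i s + if i = i' then -1 else 0)
    (hyw : ∀ j ∈ J, ∀ i ∈ I, ∀ s, y j (w i s) = y j s)
    (hzu : ∀ j ∈ K, ∀ i ∈ I, ∀ s, z j (u i s) = z j s)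
    (huw : ∀ i j s, u i (w j s) = w j (u i s)) (huw' : ∀ i s, u i (w i s) = s)
    (hx : ∀ i ∈ I, ∀ j ∈ I, i ≠ j → ∀ s, x i s ≠ x j s)
    (hx' : ∀ i ∈ I, ∀ j ∈ I, i ≠ j → ∀ s, x i s ≠ x j s - 1) :
    rowOp I (rowCoeff I J x y) u * rowOp I (rowCoeff I K x z) w -
      rowOp I (rowCoeff I K x z) w * rowOp I (rowCoeff I J x y) u =
    weightedShift (fun s => -(2 * ∑ i ∈ I, x i s - ∑ j ∈ J, y j s - ∑ j ∈ K, z j s - 1)) id := by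
  have hdiag : ∀ i ∈ I, ∑ i' ∈ I,
      (weightedShift (rowCoeff I J x y i) (u i) * weightedShift (rowCoeff I K x z i') (w i') -
        weightedShift (rowCoeff I K x z i') (w i') * weightedShift (rowCoeff I J x y i) (u i)) =
      weightedShift (fun s => rowCoeff I K x z i s * rowCoeff I J x y i (w i s) -
        rowCoeff I J x y i s * rowCoeff I K x z i (u i s)) id := by
    intro i hi
    rw [Finset.sum_eq_single i, commutator_weightedShift _ _ (huw i i)]
    · rw [show u i ∘ w i = id from funext (huw' i)]
    · intro i' hi' hii
      refine commutator_weightedShift_eq_zero (huw i i') fun s => ?_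
      rw [rowCoeff_shift (fun k hk => hxw k hk i' hi' s) (fun j hj => hyw j hj i' hi' s) hi hi'
        hii.symm (hx i hi i' hi' hii.symm s), rowCoeff_shift (fun k hk => hxu k hk i hi s)
        (fun j hj => hzu j hj i hi s) hi' hi hii (hx i' hi' i hi hii s)]
      -- With `d = x i s - x i' s`, both orders of the two shifts acquire the same factor `d / (d +
      -- 1)`, so the off-diagonal terms cancel.
      have h1 : (x i s - x i' s) / (x i s - x i' s - -1) =
          (x i' s - x i s) / (x i' s - x i s - 1) := by
        rw [← neg_div_neg_eq]
        congr 1 <;> ring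
      rw [h1]
      ring
    · exact fun h => absurd hi h
  rw [rowOp, rowOp, Module.End.commutator_sum_sum, Finset.sum_congr rfl hdiag, weightedShift_sum]
  congr 1
  funext s
  rw [← sum_residues_shifted (fun i => x i s) (fun j => y j s) (fun j => z j s)
    (fun i hi j hj h => hx i hi j hj h s) (fun i hi j hj h => hx' i hi j hj h s) hJ hK,
    ← Finset.sum_neg_distrib]
  refine Finset.sum_congr rfl fun i hi => ?_
  have e1 : rowCoeff I J x y i (w i s) =
      (∏ j ∈ J, (x i s - 1 - y j s)) / ∏ j ∈ I.erase i, (x i s - 1 - x j s) := by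
    rw [rowCoeff, hxw i hi i hi, if_pos rfl, ← sub_eq_add_neg]
    congr 1
    · exact Finset.prod_congr rfl fun j hj => by rw [hyw j hj i hi]
    · exact Finset.prod_congr rfl fun j hj => by
        rw [hxw j (Finset.mem_of_mem_erase hj) i hi, if_neg (Finset.ne_of_mem_erase hj), add_zero]
  have e2 : rowCoeff I K x z i (u i s) =
      (∏ j ∈ K, (x i s + 1 - z j s)) / ∏ j ∈ I.erase i, (x i s + 1 - x j s) := by
    rw [rowCoeff, hxu i hi i hi, if_pos rfl]
    congr 1
    · exact Finset.prod_congr rfl fun j hj => by rw [hzu j hj i hi]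
    · exact Finset.prod_congr rfl fun j hj => by
        rw [hxu j (Finset.mem_of_mem_erase hj) i hi, if_neg (Finset.ne_of_mem_erase hj), add_zero]
  rw [e1, e2, rowCoeff, rowCoeff, div_mul_div_comm, div_mul_div_comm, neg_sub,
    mul_comm (∏ j ∈ K, (x i s - z j s)),
    mul_comm (∏ j ∈ I.erase i, (x i s - x j s)) (∏ j ∈ I.erase i, (x i s - 1 - x j s))]

theorem rowOp_commute {S : Type*} {I J : Finset ℕ} {a b : ℕ → S → ℂ} {u v : ℕ → S → S}
    (h : ∀ i j s, u i (v j s) = v j (u i s))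
    (hab : ∀ i ∈ I, ∀ j ∈ J, ∀ s, b j s * a i (v j s) = a i s * b j (u i s)) :
    rowOp I a u * rowOp J b v - rowOp J b v * rowOp I a u = 0 := by
  rw [rowOp, rowOp, Module.End.commutator_sum_sum]
  exact Finset.sum_eq_zero fun i hi => Finset.sum_eq_zero fun j hj =>
    commutator_weightedShift_eq_zero (h i j) (hab i hi j hj)

theorem commutator_diagonal_rowOp {S : Type*} {I : Finset ℕ} {a : ℕ → S → ℂ} {u : ℕ → S → S}
    {η : S → ℂ} {p q : Prop} [Decidable p] [Decidable q]
    (h : ∀ i ∈ I, ∀ s, η (u i s) = η s + ((if p then 1 else 0) - if q then 1 else 0)) :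
    weightedShift η id * rowOp I a u - rowOp I a u * weightedShift η id =
      (if p then rowOp I a u else 0) - if q then rowOp I a u else 0 := by
  have key : weightedShift η id * rowOp I a u - rowOp I a u * weightedShift η id =
      ∑ i ∈ I, weightedShift
        (fun s => ((if p then 1 else 0) - if q then 1 else 0) * a i s) (u i) := by
    rw [rowOp, Module.End.commutator_sum]
    refine Finset.sum_congr rfl fun i hi => ?_
    rw [commutator_weightedShift (σ := id) (τ := u i) _ _ fun _ => rfl]
    refine congrArg₂ _ (funext fun s => ?_) rfl
    rw [h i hi, id]
    ring
  rw [key]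
  refine Finsupp.lhom_ext' fun s => LinearMap.ext_ring ?_
  split_ifs <;> simp [rowOp, LinearMap.sum_apply, weightedShift_single]

/-! ### The Gelfand–Tsetlin operators on tableaux -/

namespace GTTableau

variable {n : ℕ} {L : GTTableau n}

/-- The entry `r_{ki}` as a function of the tableau. -/
def coord (L : GTTableau n) (k i : ℕ) (R : L.shifts) : ℂ := R.1.entry k i

/-- `R ↦ R + δ^{ki}` (for `k < n`). -/
noncomputable def up (L : GTTableau n) (k i : ℕ) (R : L.shifts) : L.shifts :=
  if hk : k < n then ⟨R.1 + delta n k i, add_delta_mem_shifts R.2 hk i⟩ else R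

/-- `R ↦ R - δ^{ki}` (for `k < n`). -/
noncomputable def down (L : GTTableau n) (k i : ℕ) (R : L.shifts) : L.shifts :=
  if hk : k < n then ⟨R.1 - delta n k i, sub_delta_mem_shifts R.2 hk i⟩ else R

theorem coord_up {k i : ℕ} (hk : k < n) (hi : i ∈ Finset.Icc 1 k) (p q : ℕ) (R : L.shifts) :
    L.coord p q (L.up k i R) = L.coord p q R + if p = k ∧ q = i then 1 else 0 := by
  rw [Finset.mem_Icc] at hi
  simp only [coord, up, dif_pos hk, entry, delta, Pi.add_apply, Prod.mk.injEq]
  split_ifs <;> first | rfl | omega | simp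

theorem coord_down {k i : ℕ} (hk : k < n) (hi : i ∈ Finset.Icc 1 k) (p q : ℕ) (R : L.shifts) :
    L.coord p q (L.down k i R) = L.coord p q R + if p = k ∧ q = i then -1 else 0 := by
  rw [Finset.mem_Icc] at hi
  simp only [coord, down, dif_pos hk, entry, delta, Pi.sub_apply, Prod.mk.injEq]
  split_ifs <;> first | rfl | omega | simp [sub_eq_add_neg]

theorem coord_up_of_ne {k i p : ℕ} (hk : k < n) (hi : i ∈ Finset.Icc 1 k) (hp : p ≠ k) (q : ℕ)
    (R : L.shifts) : L.coord p q (L.up k i R) = L.coord p q R := by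
  rw [coord_up hk hi, if_neg fun h => hp h.1, add_zero]

theorem coord_down_of_ne {k i p : ℕ} (hk : k < n) (hi : i ∈ Finset.Icc 1 k) (hp : p ≠ k) (q : ℕ)
    (R : L.shifts) : L.coord p q (L.down k i R) = L.coord p q R := by
  rw [coord_down hk hi, if_neg fun h => hp h.1, add_zero]

theorem coord_up_self {k i : ℕ} (hk : k < n) (hi : i ∈ Finset.Icc 1 k) (q : ℕ) (R : L.shifts) :
    L.coord k q (L.up k i R) = L.coord k q R + if q = i then 1 else 0 := by
  simp only [coord_up hk hi, true_and]

theorem coord_down_self {k i : ℕ} (hk : k < n) (hi : i ∈ Finset.Icc 1 k) (q : ℕ) (R : L.shifts) :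
    L.coord k q (L.down k i R) = L.coord k q R + if q = i then -1 else 0 := by
  simp only [coord_down hk hi, true_and]

theorem up_up (k l i j : ℕ) (R : L.shifts) :
    L.up k i (L.up l j R) = L.up l j (L.up k i R) := by
  unfold up
  split_ifs <;> first | rfl | exact Subtype.ext (add_right_comm _ _ _)

theorem down_down (k l i j : ℕ) (R : L.shifts) :
    L.down k i (L.down l j R) = L.down l j (L.down k i R) := by
  unfold down
  split_ifs <;> first | rfl | exact Subtype.ext (sub_right_comm _ _ _)

theorem up_down (k l i j : ℕ) (R : L.shifts) :
    L.up k i (L.down l j R) = L.down l j (L.up k i R) := by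
  unfold up down
  split_ifs <;> first | rfl | exact Subtype.ext (sub_add_eq_add_sub _ _ _)

theorem up_down_cancel (k i : ℕ) (R : L.shifts) : L.up k i (L.down k i R) = R := by
  unfold up down
  split_ifs <;> first | rfl | exact Subtype.ext (sub_add_cancel _ _)

/-- Entries of tableaux in `B(T(L))` differ from those of `L` by integers, so genericity persists,
even up to an integer offset. The offsets used are `0` and `-1`. -/
theorem IsGeneric.coord_ne (hL : L.IsGeneric) {k : ℕ} (hk : k < n) (z : ℤ) :
    ∀ i ∈ Finset.Icc 1 k, ∀ j ∈ Finset.Icc 1 k, i ≠ j → ∀ R : L.shifts,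
      L.coord k i R ≠ L.coord k j R + z := by
  intro i hi j hj hij R h
  rw [Finset.mem_Icc] at hi hj
  obtain ⟨a, ha⟩ := R.2.2 k i hi.1 hi.2 hk
  obtain ⟨b, hb⟩ := R.2.2 k j hj.1 hj.2 hk
  refine hL k i j hk hi.1 hi.2 hj.1 hj.2 hij ⟨z + b - a, ?_⟩
  simp only [coord] at h
  push_cast
  linear_combination h - ha + hb

theorem IsGeneric.coord_ne_coord (hL : L.IsGeneric) {k : ℕ} (hk : k < n) :
    ∀ i ∈ Finset.Icc 1 k, ∀ j ∈ Finset.Icc 1 k, i ≠ j → ∀ R : L.shifts,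
      L.coord k i R ≠ L.coord k j R := by
  intro i hi j hj hij R h
  exact hL.coord_ne hk 0 i hi j hj hij R (by simpa using h)

/-- The coefficient of `T(R + δ^{ki})` in `-E_{k,k+1} T(R)`. -/
noncomputable abbrev upCoeff (L : GTTableau n) (k : ℕ) : ℕ → L.shifts → ℂ :=
  rowCoeff (Finset.Icc 1 k) (Finset.Icc 1 (k + 1)) (L.coord k) (L.coord (k + 1))

/-- The coefficient of `T(R - δ^{ki})` in `E_{k+1,k} T(R)`. -/
noncomputable abbrev downCoeff (L : GTTableau n) (k : ℕ) : ℕ → L.shifts → ℂ :=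
  rowCoeff (Finset.Icc 1 k) (Finset.Icc 1 (k - 1)) (L.coord k) (L.coord (k - 1))

/-- The eigenvalue of `E_{kk}` on `T(R)`. -/
noncomputable def weight (L : GTTableau n) (k : ℕ) (R : L.shifts) : ℂ :=
  (k : ℂ) - 1 + ∑ i ∈ Finset.Icc 1 k, L.coord k i R -
    ∑ i ∈ Finset.Icc 1 (k - 1), L.coord (k - 1) i R

/-- The operator `-E_{k,k+1}`. -/
noncomputable def upOp (L : GTTableau n) (k : ℕ) : Module.End ℂ L.V :=
  rowOp (Finset.Icc 1 k) (L.upCoeff k) (L.up k)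

/-- The operator `E_{k+1,k}`. -/
noncomputable def downOp (L : GTTableau n) (k : ℕ) : Module.End ℂ L.V :=
  rowOp (Finset.Icc 1 k) (L.downCoeff k) (L.down k)

/-- The operator `E_{kk}`. -/
noncomputable def weightOp (L : GTTableau n) (k : ℕ) : Module.End ℂ L.V :=
  weightedShift (L.weight k) id

theorem neg_upOp_apply_T (R : L.shifts) {k : ℕ} (hk : k < n) :
    (-L.upOp k) (T R) = raising R k hk := by
  simp only [upOp, rowOp, raising, LinearMap.neg_apply, LinearMap.sum_apply, T,
    weightedShift_single, Finsupp.smul_single, smul_eq_mul, mul_one, up, dif_pos hk, rowCoeff, coord]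

theorem downOp_apply_T (R : L.shifts) {k : ℕ} (hk : k < n) :
    L.downOp k (T R) = lowering R k hk := by
  simp only [downOp, rowOp, lowering, LinearMap.sum_apply, T,
    weightedShift_single, Finsupp.smul_single, smul_eq_mul, mul_one, down, dif_pos hk, rowCoeff,
    coord]

theorem weightOp_apply_T (R : L.shifts) (k : ℕ) : L.weightOp k (T R) = diagonal R k := by
  simp only [weightOp, diagonal, T, weightedShift_single, Finsupp.smul_single, smul_eq_mul, mul_one,
    weight, coord, id_eq]

theorem IsGeneric.shiftedRows_up (hL : L.IsGeneric) {k : ℕ} (hk : k + 1 < n) :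
    ShiftedRows (Finset.Icc 1 k) (Finset.Icc 1 (k + 1)) (L.coord k) (L.coord (k + 1)) (L.up k)
      (L.up (k + 1)) 1 where
  xu i _ i' hi' s := coord_up_self (by omega) hi' i s
  yv j _ j' hj' s := coord_up_self hk hj' j s
  xv i _ j hj s := coord_up_of_ne hk hj (by omega) i s
  yu i hi j _ s := coord_up_of_ne (by omega) hi (by omega) j s
  uu := up_up _ _
  vv := up_up _ _
  uv := up_up _ _
  hx := hL.coord_ne_coord (by omega)
  hy := hL.coord_ne_coord hk

/-- For lowering operators the rows exchange roles: the coefficients of `downOp (k + 1)` have row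
`k` in their numerators, so row `k + 1` comes first, with `ε = -1`. -/
theorem IsGeneric.shiftedRows_down (hL : L.IsGeneric) {k : ℕ} (hk : k + 1 < n) :
    ShiftedRows (Finset.Icc 1 (k + 1)) (Finset.Icc 1 k) (L.coord (k + 1)) (L.coord k)
      (L.down (k + 1)) (L.down k) (-1) where
  xu i _ i' hi' s := coord_down_self hk hi' i s
  yv j _ j' hj' s := coord_down_self (by omega) hj' j s
  xv i _ j hj s := coord_down_of_ne (by omega) hj (by omega) i s
  yu i hi j _ s := coord_down_of_ne hk hi (by omega) j s
  uu := down_down _ _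
  vv := down_down _ _
  uv := down_down _ _
  hx := hL.coord_ne_coord hk
  hy := hL.coord_ne_coord (by omega)

theorem IsGeneric.isOuterCoeff_up (hL : L.IsGeneric) {k : ℕ} (hk : k + 1 < n) :
    ShiftedRows.IsOuterCoeff (Finset.Icc 1 k) (Finset.Icc 1 (k + 1)) (L.coord (k + 1)) (L.up k)
      (L.up (k + 1)) 1 (L.upCoeff (k + 1)) where
  bu i hi j hj s := rowCoeff_congr (fun q _ => coord_up_of_ne (by omega) hi (by omega) q s)
    (fun q _ => coord_up_of_ne (by omega) hi (by omega) q s) hj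
  bv j hj j' hj' h s := rowCoeff_shift (fun q _ => coord_up_self hk hj' q s)
    (fun q _ => coord_up_of_ne hk hj' (by omega) q s) hj hj' h
    (hL.coord_ne_coord hk j hj j' hj' h s)

/-- The bound `1 ≤ k` keeps the numerator row `k - 1` distinct from row `k` under truncated
subtraction. -/
theorem IsGeneric.isOuterCoeff_down (hL : L.IsGeneric) {k : ℕ} (hk : 1 ≤ k) (hkn : k + 1 < n) :
    ShiftedRows.IsOuterCoeff (Finset.Icc 1 (k + 1)) (Finset.Icc 1 k) (L.coord k) (L.down (k + 1))
      (L.down k) (-1) (L.downCoeff k) where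
  bu i hi j hj s := rowCoeff_congr (fun q _ => coord_down_of_ne hkn hi (by omega) q s)
    (fun q _ => coord_down_of_ne hkn hi (by omega) q s) hj
  bv j hj j' hj' h s := rowCoeff_shift (fun q _ => coord_down_self (by omega) hj' q s)
    (fun q _ => coord_down_of_ne (by omega) hj' (by omega) q s) hj hj' h
    (hL.coord_ne_coord (by omega) j hj j' hj' h s)

theorem upCoeff_up {k l i j : ℕ} (hk : k < n) (hi : i ∈ Finset.Icc 1 k)
    (hj : j ∈ Finset.Icc 1 l) (h1 : l ≠ k) (h2 : l + 1 ≠ k) (R : L.shifts) :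
    L.upCoeff l j (L.up k i R) = L.upCoeff l j R :=
  rowCoeff_congr (fun q _ => coord_up_of_ne hk hi h1 q R)
    (fun q _ => coord_up_of_ne hk hi h2 q R) hj

theorem upCoeff_down {k l i j : ℕ} (hk : k < n) (hi : i ∈ Finset.Icc 1 k)
    (hj : j ∈ Finset.Icc 1 l) (h1 : l ≠ k) (h2 : l + 1 ≠ k) (R : L.shifts) :
    L.upCoeff l j (L.down k i R) = L.upCoeff l j R :=
  rowCoeff_congr (fun q _ => coord_down_of_ne hk hi h1 q R)
    (fun q _ => coord_down_of_ne hk hi h2 q R) hj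

theorem downCoeff_up {k l i j : ℕ} (hk : k < n) (hi : i ∈ Finset.Icc 1 k)
    (hj : j ∈ Finset.Icc 1 l) (h1 : l ≠ k) (h2 : l - 1 ≠ k) (R : L.shifts) :
    L.downCoeff l j (L.up k i R) = L.downCoeff l j R :=
  rowCoeff_congr (fun q _ => coord_up_of_ne hk hi h1 q R)
    (fun q _ => coord_up_of_ne hk hi h2 q R) hj

theorem downCoeff_down {k l i j : ℕ} (hk : k < n) (hi : i ∈ Finset.Icc 1 k)
    (hj : j ∈ Finset.Icc 1 l) (h1 : l ≠ k) (h2 : l - 1 ≠ k) (R : L.shifts) :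
    L.downCoeff l j (L.down k i R) = L.downCoeff l j R :=
  rowCoeff_congr (fun q _ => coord_down_of_ne hk hi h1 q R)
    (fun q _ => coord_down_of_ne hk hi h2 q R) hj

theorem commutator_upOp_downOp_of_ne {k l : ℕ} (hkn : k < n) (hl : 1 ≤ l)
    (hln : l < n) (hkl : k ≠ l) : L.upOp k * L.downOp l - L.downOp l * L.upOp k = 0 := by
  refine rowOp_commute (up_down _ _) fun i hi j hj R => ?_
  -- Only here do the operators see each other's rows. With `x = r_{ki}` and `y = r_{k+1,j}`, the
  -- two orders give `(y - x)(x - (y - 1))` and `(x - y)(y - (x + 1))`, which are equal.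
  by_cases h : l = k + 1
  · subst h
    have hi' : i ∈ Finset.Icc 1 (k + 1 - 1) := hi
    unfold upCoeff downCoeff
    rw [rowCoeff_erase _ _ _ i hj, rowCoeff_erase _ _ _ i hj, rowCoeff_erase _ _ _ j hi',
      rowCoeff_erase _ _ _ j hi', coord_down_self hln hj, coord_down_of_ne hln hj (by omega),
      coord_up_of_ne hkn hi (by omega), show k + 1 - 1 = k from rfl, coord_up_self hkn hi,
      if_pos rfl, if_pos rfl]
    have e1 : rowCoeff (Finset.Icc 1 k) ((Finset.Icc 1 (k + 1)).erase j) (L.coord k)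
        (L.coord (k + 1)) i (L.down (k + 1) j R) = rowCoeff (Finset.Icc 1 k)
          ((Finset.Icc 1 (k + 1)).erase j) (L.coord k) (L.coord (k + 1)) i R :=
      rowCoeff_congr (fun q _ => coord_down_of_ne hln hj (by omega) q R) (fun q hq => by
        rw [coord_down_self hln hj, if_neg (Finset.ne_of_mem_erase hq), add_zero]) hi
    have e2 : rowCoeff (Finset.Icc 1 (k + 1)) ((Finset.Icc 1 k).erase i) (L.coord (k + 1))
        (L.coord k) j (L.up k i R) = rowCoeff (Finset.Icc 1 (k + 1))
          ((Finset.Icc 1 k).erase i) (L.coord (k + 1)) (L.coord k) j R :=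
      rowCoeff_congr (fun q _ => coord_up_of_ne hkn hi (by omega) q R) (fun q hq => by
        rw [coord_up_self hkn hi, if_neg (Finset.ne_of_mem_erase hq), add_zero]) hj
    rw [e1, e2]
    ring
  · rw [downCoeff_up hkn hi hj (Ne.symm hkl) (by omega)]
    by_cases h' : k + 1 = l
    · omega
    · rw [upCoeff_down hln hj hi hkl h', mul_comm]

theorem weight_up {p k i : ℕ} (hp : 1 ≤ p) (hk : 1 ≤ k) (hkn : k < n) (hi : i ∈ Finset.Icc 1 k)
    (R : L.shifts) : L.weight p (L.up k i R) =
      L.weight p R + ((if p = k then 1 else 0) - if p = k + 1 then 1 else 0) := by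
  have hs : ∀ q, ∑ j ∈ Finset.Icc 1 q, L.coord q j (L.up k i R) =
      ∑ j ∈ Finset.Icc 1 q, L.coord q j R + if q = k then 1 else 0 := by
    intro q
    split_ifs with h
    · subst h
      simp only [coord_up_self hkn hi, Finset.sum_add_distrib, Finset.sum_ite_eq', if_pos hi]
    · simp only [coord_up_of_ne hkn hi h, add_zero]
  have h2 : p - 1 = k ↔ p = k + 1 := by omega
  rw [weight, weight, hs, hs]
  simp only [h2]
  ring

theorem weight_down {p k i : ℕ} (hp : 1 ≤ p) (hk : 1 ≤ k) (hkn : k < n) (hi : i ∈ Finset.Icc 1 k)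
    (R : L.shifts) : L.weight p (L.down k i R) =
      L.weight p R + ((if p = k + 1 then 1 else 0) - if p = k then 1 else 0) := by
  have hs : ∀ q, ∑ j ∈ Finset.Icc 1 q, L.coord q j (L.down k i R) =
      ∑ j ∈ Finset.Icc 1 q, L.coord q j R - if q = k then 1 else 0 := by
    intro q
    split_ifs with h
    · subst h
      simp only [coord_down_self hkn hi, Finset.sum_add_distrib, Finset.sum_ite_eq', if_pos hi,
        sub_eq_add_neg]
    · simp only [coord_down_of_ne hkn hi h, sub_zero]
  have h2 : p - 1 = k ↔ p = k + 1 := by omega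
  rw [weight, weight, hs, hs]
  simp only [h2]
  ring

/-- The residue sum equals the difference of the weights. Row `k + 1` enters only through
numerators, so `k + 1 = n` is allowed with no condition on the top row. -/
theorem IsGeneric.commutator_upOp_downOp (hL : L.IsGeneric) {k : ℕ} (hk : 1 ≤ k) (hkn : k < n) :
    L.upOp k * L.downOp k - L.downOp k * L.upOp k = -(L.weightOp k - L.weightOp (k + 1)) := by
  rw [upOp, downOp, commutator_raising_lowering (by simp) (by simp; omega)
    (fun i _ i' hi' s => coord_up_self hkn hi' i s)
    (fun i _ i' hi' s => coord_down_self hkn hi' i s)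
    (fun j _ i hi s => coord_down_of_ne hkn hi (by omega) j s)
    (fun j _ i hi s => coord_up_of_ne hkn hi (by omega) j s)
    (up_down k k) (up_down_cancel k) (hL.coord_ne_coord hkn)
    (fun i hi j hj h s => by simpa [sub_eq_add_neg] using hL.coord_ne hkn (-1) i hi j hj h s),
    weightOp, weightOp, weightedShift_sub, weightedShift_neg]
  congr 1
  funext R
  rw [weight, weight, Nat.add_sub_cancel]
  push_cast
  ring

/-- The bracket on endomorphisms unfolds to `A * B - B * A`, so the commutator lemmas apply
directly. The exchange of rows for lowering operators makes `serre_left` supply the upper Serre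
relation for `f` and `serre_right` the lower one. -/
theorem IsGeneric.isGLGenerators (hL : L.IsGeneric) :
    IsGLGenerators (Λ := Module.End ℂ L.V) n (fun k => -L.upOp k) L.downOp L.weightOp :=
  IsGLGenerators.of_neg
    (hh := fun _ _ _ _ _ _ => commutator_weightedShift_eq_zero (fun _ => rfl) fun _ => mul_comm _ _)
    (ha := fun _ _ hp _ hk hkn => commutator_diagonal_rowOp fun _ hi R => weight_up hp hk hkn hi R)
    (hf := fun _ _ hp _ hk hkn => commutator_diagonal_rowOp fun _ hi R => weight_down hp hk hkn hi R)
    (af := fun _ hk hkn => hL.commutator_upOp_downOp hk hkn)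
    (af_ne := fun _ _ _ hkn hl hln h => commutator_upOp_downOp_of_ne hkn hl hln h)
    (aa := fun k l hk hkl hln => rowOp_commute (up_up _ _) fun i hi j hj R => by
      rw [upCoeff_up hln hj hi (by omega) (by omega),
        upCoeff_up (by omega) hi hj (by omega) (by omega), mul_comm])
    (ff := fun k l hk hkl hln => rowOp_commute (down_down _ _) fun i hi j hj R => by
      rw [downCoeff_down hln hj hi (by omega) (by omega),
        downCoeff_down (by omega) hi hj (by omega) (by omega), mul_comm])
    (serre_a_lower := fun _ _ hkn =>
      (hL.shiftedRows_up hkn).serre_left (hL.isOuterCoeff_up hkn) rfl rfl)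
    (serre_a_upper := fun _ _ hkn =>
      (hL.shiftedRows_up hkn).serre_right (hL.isOuterCoeff_up hkn) rfl rfl)
    (serre_f_lower := fun _ hk hkn =>
      (hL.shiftedRows_down hkn).serre_right (hL.isOuterCoeff_down hk hkn) rfl rfl)
    (serre_f_upper := fun _ hk hkn =>
      (hL.shiftedRows_down hkn).serre_left (hL.isOuterCoeff_down hk hkn) rfl rfl)

end GTTableau

/-! ### The homomorphism from `gl_n` and the module structure -/

/-- The Lie algebra homomorphism from `gl_n` determined by images of the elementary matrices. -/
def IsGLFamily.toLieHom {Λ : Type*} [LieRing Λ] [LieAlgebra ℂ Λ] {n : ℕ} {E : ℕ → ℕ → Λ}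
    (hE : IsGLFamily n E) : Matrix (Fin n) (Fin n) ℂ →ₗ⁅ℂ⁆ Λ where
  toFun M := ∑ a, ∑ b, M a b • E (a + 1) (b + 1)
  map_add' M N := by
    simp only [Matrix.add_apply, add_smul, Finset.sum_add_distrib]
  map_smul' c M := by
    simp only [Matrix.smul_apply, smul_eq_mul, mul_smul, Finset.smul_sum, RingHom.id_apply]
  map_lie' {M N} := by
    have h : ∀ a b c d : Fin n, ⁅E (a + 1) (b + 1), E (c + 1) (d + 1)⁆ =
        (if b = c then E (a + 1) (d + 1) else 0) - if d = a then E (c + 1) (b + 1) else 0 := by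
      intro a b c d
      rw [hE _ _ _ _ (by omega) (by omega) (by omega) (by omega) (by omega) (by omega) (by omega)
        (by omega)]
      simp only [add_left_inj, Fin.val_inj]
    have h1 : ⁅∑ a, ∑ b, M a b • E (a + 1) (b + 1), ∑ c, ∑ d, N c d • E (c + 1) (d + 1)⁆ =
        ∑ a, ∑ d, ∑ b, (M a b * N b d) • E (a + 1) (d + 1) -
          ∑ c, ∑ b, ∑ a, (N c a * M a b) • E (c + 1) (b + 1) := by
      simp only [sum_lie, lie_sum, smul_lie, lie_smul, h, smul_sub, Finset.sum_sub_distrib]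
      congr 1
      · simp only [smul_ite, smul_zero, Finset.sum_ite_eq', Finset.mem_univ, if_true,
          Finset.smul_sum, smul_smul, mul_comm]
        rw [Finset.sum_comm]
        conv_rhs => rw [Finset.sum_comm]
        exact Finset.sum_congr rfl fun d _ => Finset.sum_comm
      · refine Finset.sum_congr rfl fun c _ => ?_
        conv_rhs => rw [Finset.sum_comm]
        refine Finset.sum_congr rfl fun a _ => ?_
        rw [Finset.sum_comm]
        simp only [smul_ite, smul_zero, Finset.sum_ite_eq, Finset.mem_univ, if_true,
          Finset.smul_sum, smul_smul]
    rw [h1]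
    simp only [LieRing.of_associative_ring_bracket, Matrix.sub_apply, Matrix.mul_apply, sub_smul,
      Finset.sum_smul, Finset.sum_sub_distrib]

theorem IsGLFamily.toLieHom_glE {Λ : Type*} [LieRing Λ] [LieAlgebra ℂ Λ] {n : ℕ} {E : ℕ → ℕ → Λ}
    (hE : IsGLFamily n E) {i j : ℕ} (hi : 1 ≤ i) (hi' : i ≤ n) (hj : 1 ≤ j) (hj' : j ≤ n) :
    hE.toLieHom (glE n i j) = E i j := by
  change ∑ a : Fin n, ∑ b : Fin n, glE n i j a b • E (a + 1) (b + 1) = E i j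
  obtain ⟨i, rfl⟩ : ∃ k, k + 1 = i := ⟨i - 1, by omega⟩
  obtain ⟨j, rfl⟩ : ∃ k, k + 1 = j := ⟨j - 1, by omega⟩
  rw [Finset.sum_eq_single (⟨i, hi'⟩ : Fin n), Finset.sum_eq_single (⟨j, hj'⟩ : Fin n)]
  · simp [glE]
  · intro b _ hb
    rw [glE, Matrix.of_apply, if_neg, zero_smul]
    rintro ⟨-, h⟩
    exact hb (Fin.ext (by simpa using h))
  · simp
  · intro a _ ha
    refine Finset.sum_eq_zero fun b _ => ?_
    rw [glE, Matrix.of_apply, if_neg, zero_smul]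
    rintro ⟨h, -⟩
    exact ha (Fin.ext (by simpa using h))
  · simp

theorem mainTheorem10 (n : ℕ) (hn : 2 ≤ n) (L : GTTableau n) (hL : L.IsGeneric) :
    ∃ (_ : LieRingModule (Matrix (Fin n) (Fin n) ℂ) L.V)
      (_ : LieModule ℂ (Matrix (Fin n) (Fin n) ℂ) L.V),
      ∀ R : L.shifts,
        (∀ (k : ℕ) (_ : 1 ≤ k) (hk : k < n),
          ⁅glE n k (k + 1), GTTableau.T R⁆ = GTTableau.raising R k hk) ∧
        (∀ (k : ℕ) (_ : 1 ≤ k) (hk : k < n),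
          ⁅glE n (k + 1) k, GTTableau.T R⁆ = GTTableau.lowering R k hk) ∧
        (∀ k : ℕ, 1 ≤ k → k ≤ n →
          ⁅glE n k k, GTTableau.T R⁆ = GTTableau.diagonal R k) := by
  obtain ⟨E, hE, he, hf, hh⟩ := hL.isGLGenerators.exists_isGLFamily (by omega) le_rfl
  -- The tautological module of the endomorphism algebra is pulled back along the homomorphism, so
  -- each bracket is evaluation of an operator at `T R`.
  refine ⟨LieRingModule.compLieHom L.V hE.toLieHom, LieModule.compLieHom L.V hE.toLieHom,
    fun R => ⟨fun k hk hkn => ?_, fun k hk hkn => ?_, fun k hk hkn => ?_⟩⟩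
  · change hE.toLieHom (glE n k (k + 1)) (GTTableau.T R) = _
    rw [hE.toLieHom_glE hk hkn.le (by omega) hkn, he k hk hkn, GTTableau.neg_upOp_apply_T]
  · change hE.toLieHom (glE n (k + 1) k) (GTTableau.T R) = _
    rw [hE.toLieHom_glE (by omega) hkn hk hkn.le, hf k hk hkn, GTTableau.downOp_apply_T]
  · change hE.toLieHom (glE n k k) (GTTableau.T R) = _
    rw [hE.toLieHom_glE hk hkn hk hkn, hh k hk hkn, GTTableau.weightOp_apply_T]
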